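/- Let $l_i<u_i$ for $i=1,\dots,n$, let $B=\{x\in\mathbb R^n : l_i\le x_i\le u_i,\ i=1,\dots,n\}$, and let $K_i^-<K_i^+$ be finite real numbers, $i=1,\dots,n$. A continuously differentiable function $h$ is said to have $K$-bounded derivatives over $B$ if $K_i^-\le \frac{\partial h(x)}{\partial x_i}\le K_i^+$ for all $x\in B$ and $i=1,\dots,n$. A set is called full-dimensional if its interior is nonempty. Suppose: 1. The random vectors $X_1,X_2,\dots$ in $\mathbb R^n$ are independent and identically distributed, with $E[\|X_1\|^2]<\infty$. 2. $P(X_i\in B)=1$, and $P(X_i\in C)>0$ for every full-dimensional set $C\subseteq B$. 3. $Y_i=f(X_i)+\nu_i$ for all $i\geq 1$, where $f:B\to\mathbb R$ is continuous and the $\nu_i$ are real random variables such that, for every $m$ and all Borel sets $A_1,\dots,A_m\subseteq\mathbb R$, $P(\nu_1\in A_1,\dots,\nu_m\in A_m\mid X_1,\dots,X_m)=\prod_{i=1}^m P(\nu_i\in A_i\mid X_i)$ almost surely, $E[\nu_i\mid X_i]=0$ almost surely, and $E[\nu_i^2]=\sigma^2<\infty$ with $\sigma^2$ the same for all $i$.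 Suppose that $f$ has $K$-bounded derivatives over $B$. For $m\ge 0$ and $d\ge 1$, let $\bar h_{m,d}$ be a solution (any solution, if there are several) of $$\min_h\ \sum_{i=1}^m (Y_i-h(X_i))^2$$ over all polynomials $h$ in $n$ variables of degree at most $d$ that have $K$-bounded derivatives over $B$. Then, for every compact full-dimensional set $C\subseteq B$ that contains no point of the boundary of $B$, almost surely, $$\sup_{x\in C}|\bar h_{m,d}(x)-f(x)|\to 0\quad\text{as } m\to\infty \text{ and } d\to\infty \text{ (jointly)}.$$ -/

import Mathlib

open MeasureTheory ProbabilityTheory Filter Topology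

noncomputable section

/-- The box `{x ∈ ℝⁿ | l i ≤ x i ≤ u i for all i}`. -/
def box {n : ℕ} (l u : Fin n → ℝ) : Set (Fin n → ℝ) :=
  {x | ∀ i, l i ≤ x i ∧ x i ≤ u i}

/-- A subset of `ℝⁿ` is full-dimensional when it has nonempty interior. -/
def FullDimensional {n : ℕ} (C : Set (Fin n → ℝ)) : Prop :=
  (interior C).Nonempty

/-- `f` is continuously differentiable on `B` and its partial derivatives satisfy
`Kminus i ≤ ∂f/∂xᵢ ≤ Kplus i` on `B`. Only the values of `f` on `B` matter: derivatives are taken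
within `B`, where they are uniquely determined if `B` is a full-dimensional box
(they are one-sided at the faces). -/
def HasKBoundedDerivatives {n : ℕ} (Kminus Kplus : Fin n → ℝ) (B : Set (Fin n → ℝ))
    (f : (Fin n → ℝ) → ℝ) : Prop :=
  ContDiffOn ℝ 1 f B ∧
    ∀ i, ∀ x ∈ B, Kminus i ≤ fderivWithin ℝ f B x (Pi.single i 1) ∧
      fderivWithin ℝ f B x (Pi.single i 1) ≤ Kplus i

/-- The polynomials in `n` variables of degree at most `d` which have `K`-bounded derivatives
over `B`. -/
def feasiblePolynomials {n : ℕ} (Kminus Kplus : Fin n → ℝ) (B : Set (Fin n → ℝ)) (d : ℕ) :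
    Set (MvPolynomial (Fin n) ℝ) :=
  {p | p.totalDegree ≤ d ∧ HasKBoundedDerivatives Kminus Kplus B (fun x => MvPolynomial.eval x p)}

/-- The sum of squared residuals of `p` on the first `m` data points. -/
def squaredLoss {n : ℕ} (m : ℕ) (x : ℕ → Fin n → ℝ) (y : ℕ → ℝ)
    (p : MvPolynomial (Fin n) ℝ) : ℝ :=
  ∑ i ∈ Finset.range m, (y i - MvPolynomial.eval (x i) p) ^ 2

/-- `p` solves the least-squares problem over the polynomials of degree at most `d` with
`K`-bounded derivatives over `B`, for the first `m` data points. -/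
def IsBoundedDerivativeRegressor {n : ℕ} (Kminus Kplus : Fin n → ℝ) (B : Set (Fin n → ℝ))
    (m d : ℕ) (x : ℕ → Fin n → ℝ) (y : ℕ → ℝ) (p : MvPolynomial (Fin n) ℝ) : Prop :=
  p ∈ feasiblePolynomials Kminus Kplus B d ∧
    ∀ q ∈ feasiblePolynomials Kminus Kplus B d, squaredLoss m x y p ≤ squaredLoss m x y q

/-- The feature vectors are independent and identically distributed with finite second moment
(of the Euclidean norm). -/
structure FeaturesIID {Ω : Type*} [MeasurableSpace Ω] (μ : Measure Ω) {n : ℕ}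
    (X : ℕ → Ω → Fin n → ℝ) : Prop where
  measurable : ∀ i, Measurable (X i)
  indep : iIndepFun X μ
  identDistrib : ∀ i, IdentDistrib (X i) (X 0) μ μ
  secondMoment : Integrable (fun ω => ∑ j, (X 0 ω j) ^ 2) μ

/-- The feature vectors lie in `B` almost surely and charge every full-dimensional subset
of `B`. -/
structure FeaturesSupportedOn {Ω : Type*} [MeasurableSpace Ω] (μ : Measure Ω) {n : ℕ}
    (X : ℕ → Ω → Fin n → ℝ) (B : Set (Fin n → ℝ)) : Prop where
  ae_mem : ∀ i, ∀ᵐ ω ∂μ, X i ω ∈ B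
  pos : ∀ i, ∀ C ⊆ B, FullDimensional C → 0 < μ (X i ⁻¹' C)

/-- `Y i = f (X i) + ν i` with `f` continuous on `B`, where the noise is conditionally independent
given the features (with the conditional law of `ν i` depending on `X i` only), conditionally
centered, and of finite variance `σ²` which is the same for all `i`. -/
structure NoisyResponses {Ω : Type*} [MeasurableSpace Ω] (μ : Measure Ω) {n : ℕ}
    (X : ℕ → Ω → Fin n → ℝ) (Y ν : ℕ → Ω → ℝ) (B : Set (Fin n → ℝ)) (f : (Fin n → ℝ) → ℝ)
    (σ : ℝ) : Prop where
  continuousOn : ContinuousOn f B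
  response : ∀ i, ∀ᵐ ω ∂μ, Y i ω = f (X i ω) + ν i ω
  measurable : ∀ i, Measurable (ν i)
  condIndep : ∀ (m : ℕ) (A : Fin m → Set ℝ), (∀ i, MeasurableSet (A i)) →
    μ⟦⋂ i : Fin m, ν i ⁻¹' A i | ⨆ i : Fin m, MeasurableSpace.comap (X i) inferInstance⟧
      =ᵐ[μ] fun ω => ∏ i : Fin m, (μ⟦ν i ⁻¹' A i | MeasurableSpace.comap (X i) inferInstance⟧) ω
  condMean : ∀ i, μ[ν i | MeasurableSpace.comap (X i) inferInstance] =ᵐ[μ] 0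
  memLp : ∀ i, MemLp (ν i) 2 μ
  secondMoment : ∀ i, ∫ ω, (ν i ω) ^ 2 ∂μ = σ ^ 2

end

/-! The derivative bounds make all feasible polynomials, and `f`, equi-Lipschitz on the box.
Bernstein operators preserve these bounds, so some feasible polynomial `q` of a fixed degree is
uniformly close to `f`. Once `d` exceeds that degree, comparing the minimizer `p` with `q` bounds
the empirical sum of `(p - f) ^ 2` by a small term plus the noise sum `∑ v i * (p - q) (x i)`.

The noise sum is small uniformly over the equi-Lipschitz class: on a fine finite partition `p - q`
is nearly constant on each cell, and on each cell the noise averages to zero by a strong law.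
Conversely, if `M = max |p - f|` is attained at `z`, then `|p - f| ≥ M / 2` on a ball near `z` which
receives a positive fraction of the sample. The derivative bounds do not control additive constants,
so `M` has no a priori bound; but the lower estimate is quadratic in `M` and the noise estimate only
affine, so a large `M` is excluded as well.

Probability enters through countably many almost sure events
(`NoisyResponses.ae_tendsto_cell_noise`, `NoisyResponses.ae_sum_abs_noise_le`,
`FeaturesIID.ae_mass_le`); the rest, `eventually_regressor_close`, is deterministic. The
approximation is `SlopeBounded.exists_mvPolynomial_close`. -/

/-! ### A strong law of large numbers for orthogonal sequences -/

theorem integral_sq_sum_le_of_orthogonal {Ω : Type*} [MeasurableSpace Ω] {μ : Measure Ω}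
    {Z : ℕ → Ω → ℝ} {V : ℝ} (hL2 : ∀ i, MemLp (Z i) 2 μ)
    (horth : ∀ i j, i ≠ j → ∫ ω, Z i ω * Z j ω ∂μ = 0)
    (hV : ∀ i, ∫ ω, Z i ω ^ 2 ∂μ ≤ V) (s : Finset ℕ) :
    ∫ ω, (∑ i ∈ s, Z i ω) ^ 2 ∂μ ≤ s.card * V := by
  have hint : ∀ i j, Integrable (fun ω => Z i ω * Z j ω) μ := fun i j =>
    (hL2 i).integrable_mul (hL2 j)
  have : ∫ ω, (∑ i ∈ s, Z i ω) ^ 2 ∂μ = ∑ i ∈ s, ∫ ω, Z i ω ^ 2 ∂μ := by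
    simp_rw [sq, Finset.sum_mul_sum]
    rw [integral_finsetSum _ fun i _ => integrable_finsetSum _ fun j _ => hint i j]
    refine Finset.sum_congr rfl fun i hi => ?_
    rw [integral_finsetSum _ fun j _ => hint i j]
    exact Finset.sum_eq_single_of_mem i hi fun j _ hj => horth i j hj.symm
  rw [this]
  calc _ ≤ ∑ i ∈ s, V := Finset.sum_le_sum fun i _ => hV i
    _ = _ := by simp

/-- The sum of the `W k` has finite integral, hence is finite almost everywhere, and the terms of a
convergent series tend to zero. -/
theorem ae_tendsto_zero_of_summable_integral {Ω : Type*} [MeasurableSpace Ω] {μ : Measure Ω}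
    {W : ℕ → Ω → ℝ} (hW : ∀ k, Integrable (W k) μ) (hnn : ∀ k ω, 0 ≤ W k ω) {b : ℕ → ℝ}
    (hb : Summable b) (hle : ∀ k, ∫ ω, W k ω ∂μ ≤ b k) :
    ∀ᵐ ω ∂μ, Tendsto (fun k => W k ω) atTop (𝓝 0) := by
  have hb0 : ∀ k, 0 ≤ b k := fun k => (integral_nonneg (hnn k)).trans (hle k)
  have hm : ∀ k, AEMeasurable (fun ω => ENNReal.ofReal (W k ω)) μ := fun k =>
    (hW k).aestronglyMeasurable.aemeasurable.ennreal_ofReal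
  have h1 : ∫⁻ ω, ∑' k, ENNReal.ofReal (W k ω) ∂μ ≠ ⊤ := by
    rw [lintegral_tsum hm]
    refine ne_top_of_le_ne_top (b := ∑' k, ENNReal.ofReal (b k)) ?_
      (ENNReal.tsum_le_tsum fun k => ?_)
    · rw [← ENNReal.ofReal_tsum_of_nonneg hb0 hb]
      exact ENNReal.ofReal_ne_top
    · rw [← ofReal_integral_eq_lintegral_ofReal (hW k) (ae_of_all _ (hnn k))]
      exact ENNReal.ofReal_le_ofReal (hle k)
  filter_upwards [ae_lt_top' (AEMeasurable.tsum hm) h1] with ω hω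
  have h2 := ENNReal.tendsto_atTop_zero_of_tsum_ne_top hω.ne
  have h3 := (ENNReal.tendsto_toReal ENNReal.zero_ne_top).comp h2
  simpa [Function.comp_def, ENNReal.toReal_ofReal (hnn _ ω)] using h3

/-- A strong law of large numbers for orthogonal sequences with bounded second moments. -/
theorem ae_tendsto_average_of_orthogonal {Ω : Type*} [MeasurableSpace Ω] {μ : Measure Ω}
    {Z : ℕ → Ω → ℝ} {V : ℝ} (hL2 : ∀ i, MemLp (Z i) 2 μ)
    (horth : ∀ i j, i ≠ j → ∫ ω, Z i ω * Z j ω ∂μ = 0)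
    (hV : ∀ i, ∫ ω, Z i ω ^ 2 ∂μ ≤ V) :
    ∀ᵐ ω ∂μ, Tendsto (fun m : ℕ => (∑ i ∈ Finset.range m, Z i ω) / m) atTop (𝓝 0) := by
  have hV0 : 0 ≤ V := (integral_nonneg fun ω => sq_nonneg _).trans (hV 0)
  let S : Finset ℕ → Ω → ℝ := fun s ω => ∑ i ∈ s, Z i ω
  have hS : ∀ s (c : ℝ), Integrable (fun ω => (S s ω / c) ^ 2) μ := fun s c => by
    have : MemLp (S s) 2 μ := memLp_finsetSum _ fun i _ => hL2 i
    simp_rw [div_pow]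
    exact this.integrable_sq.div_const _
  have hSle : ∀ s (c : ℝ), ∫ ω, (S s ω / c) ^ 2 ∂μ ≤ s.card * V / c ^ 2 := fun s c => by
    simp_rw [div_pow, integral_div]
    gcongr
    exact integral_sq_sum_le_of_orthogonal hL2 horth hV s
  -- `W k` controls the average at `k ^ 2` and at every `m` up to the next square. The maximum over
  -- the block is replaced by a sum of `2 * k + 1` terms, each of mean at most `3 * k * V / k ^ 4`,
  -- so the total is still `O(1 / k ^ 2)`.
  let W : ℕ → Ω → ℝ := fun k ω => (S (Finset.range (k ^ 2)) ω / (k : ℝ) ^ 2) ^ 2 +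
    ∑ j ∈ Finset.range (2 * k + 1), (S (Finset.Ico (k ^ 2) (k ^ 2 + j)) ω / (k : ℝ) ^ 2) ^ 2
  have hW : ∀ k, Integrable (W k) μ := fun k =>
    (hS _ _).add (integrable_finsetSum _ fun j _ => hS _ _)
  have hWle : ∀ k, ∫ ω, W k ω ∂μ ≤ 10 * V * (1 / (k : ℝ) ^ 2) := by
    intro k
    rcases Nat.eq_zero_or_pos k with rfl | hk
    -- Division by zero makes both sides vanish.
    · simp [W]
    have hk1 : (1 : ℝ) ≤ k := by exact_mod_cast hk
    have e : ∫ ω, W k ω ∂μ = ∫ ω, (S (Finset.range (k ^ 2)) ω / (k : ℝ) ^ 2) ^ 2 ∂μ +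
        ∑ j ∈ Finset.range (2 * k + 1),
          ∫ ω, (S (Finset.Ico (k ^ 2) (k ^ 2 + j)) ω / (k : ℝ) ^ 2) ^ 2 ∂μ := by
      rw [← integral_finsetSum _ fun j _ => hS _ _]
      exact integral_add (hS _ _) (integrable_finsetSum _ fun j _ => hS _ _)
    rw [e]
    have h1 := hSle (Finset.range (k ^ 2)) ((k : ℝ) ^ 2)
    have h2 : ∑ j ∈ Finset.range (2 * k + 1),
          ∫ ω, (S (Finset.Ico (k ^ 2) (k ^ 2 + j)) ω / (k : ℝ) ^ 2) ^ 2 ∂μ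
        ≤ ∑ j ∈ Finset.range (2 * k + 1), (3 * k) * V / ((k : ℝ) ^ 2) ^ 2 := by
      refine Finset.sum_le_sum fun j hj => (hSle _ _).trans ?_
      have : (j : ℝ) ≤ 3 * k := by
        have := Finset.mem_range.1 hj
        exact_mod_cast (by omega : j ≤ 3 * k)
      simp only [Nat.card_Ico, add_tsub_cancel_left]
      gcongr
    rw [Finset.card_range] at h1
    rw [Finset.sum_const, Finset.card_range, nsmul_eq_mul] at h2
    push_cast at h1 h2
    refine (add_le_add h1 h2).trans ?_
    have : (2 * (k : ℝ) + 1) * (3 * k * V / ((k : ℝ) ^ 2) ^ 2) ≤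
        (2 * (k : ℝ) + k) * (3 * k * V / ((k : ℝ) ^ 2) ^ 2) := by gcongr
    refine (add_le_add le_rfl this).trans (le_of_eq ?_)
    field_simp
    ring
  have hsum : Summable fun k : ℕ => 10 * V * (1 / (k : ℝ) ^ 2) :=
    (Real.summable_one_div_nat_pow.2 one_lt_two).mul_left _
  filter_upwards [ae_tendsto_zero_of_summable_integral hW
    (fun k ω => by positivity) hsum hWle] with ω hω
  have hsqrt : Tendsto Nat.sqrt atTop atTop := by
    refine tendsto_atTop.2 fun b => ?_
    filter_upwards [eventually_ge_atTop (b * b)] with m hm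
    exact Nat.le_sqrt.2 hm
  have h2 : Tendsto (fun m => 2 * W (Nat.sqrt m) ω) atTop (𝓝 0) := by
    simpa using (hω.comp hsqrt).const_mul 2
  have h3 : Tendsto (fun m : ℕ => ((∑ i ∈ Finset.range m, Z i ω) / m) ^ 2) atTop (𝓝 0) := by
    refine squeeze_zero' (Eventually.of_forall fun m => sq_nonneg _) ?_ h2
    filter_upwards [eventually_ge_atTop 1] with m hm
    set k := Nat.sqrt m with hk
    have hk1 : 1 ≤ k := Nat.le_sqrt.2 (by simpa using hm)
    have hkm : k ^ 2 ≤ m := by rw [sq]; exact Nat.sqrt_le m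
    have hmk : m ≤ k ^ 2 + 2 * k := by
      have := Nat.sqrt_le_add m
      rw [← hk] at this
      nlinarith
    have hsplit : ∑ i ∈ Finset.range m, Z i ω =
        S (Finset.range (k ^ 2)) ω + S (Finset.Ico (k ^ 2) (k ^ 2 + (m - k ^ 2))) ω := by
      rw [Nat.add_sub_cancel' hkm]
      exact (Finset.sum_range_add_sum_Ico _ hkm).symm
    have hj : (S (Finset.Ico (k ^ 2) (k ^ 2 + (m - k ^ 2))) ω / (k : ℝ) ^ 2) ^ 2 ≤
        ∑ j ∈ Finset.range (2 * k + 1), (S (Finset.Ico (k ^ 2) (k ^ 2 + j)) ω / (k : ℝ) ^ 2) ^ 2 :=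
      Finset.single_le_sum
        (f := fun j => (S (Finset.Ico (k ^ 2) (k ^ 2 + j)) ω / (k : ℝ) ^ 2) ^ 2)
        (fun j _ => sq_nonneg _) (Finset.mem_range.2 (by omega))
    have hk0 : (0 : ℝ) < (k : ℝ) ^ 2 := by positivity
    have hkm' : (k : ℝ) ^ 2 ≤ m := by exact_mod_cast hkm
    rw [hsplit]
    set a := S (Finset.range (k ^ 2)) ω
    set b := S (Finset.Ico (k ^ 2) (k ^ 2 + (m - k ^ 2))) ω
    calc ((a + b) / (m : ℝ)) ^ 2 ≤ ((a + b) / (k : ℝ) ^ 2) ^ 2 := by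
          rw [div_pow, div_pow]
          gcongr
      _ = (a / (k : ℝ) ^ 2 + b / (k : ℝ) ^ 2) ^ 2 := by rw [add_div]
      _ ≤ 2 * ((a / (k : ℝ) ^ 2) ^ 2 + (b / (k : ℝ) ^ 2) ^ 2) := add_sq_le
      _ ≤ 2 * W k ω := by
          simp only [W]
          gcongr
  have h4 := (Real.continuous_sqrt.tendsto 0).comp h3
  simp only [Function.comp_def, Real.sqrt_sq_eq_abs, Real.sqrt_zero] at h4
  exact (tendsto_zero_iff_abs_tendsto_zero _).2 h4

/-! ### Pairwise independence of the (feature, noise) pairs -/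

theorem setIntegral_condExp_indicator_one {Ω : Type*} {G mΩ : MeasurableSpace Ω} {μ : Measure Ω}
    [IsFiniteMeasure μ] (hG : G ≤ mΩ) {s t : Set Ω} (hs : MeasurableSet[G] s)
    (ht : MeasurableSet[mΩ] t) : ∫ ω in s, (μ⟦t | G⟧) ω ∂μ = μ.real (s ∩ t) := by
  rw [setIntegral_condExp hG ((integrable_const 1).indicator ht) hs,
    integral_indicator_const _ ht, measureReal_restrict_apply ht, Set.inter_comm]
  simp

/-- Under the conditional independence of the noise, the pairs `(X i, ν i)` satisfy the product
rule on measurable rectangles. -/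
theorem NoisyResponses.measure_rectangles {Ω : Type*} [mΩ : MeasurableSpace Ω] {μ : Measure Ω}
    [IsProbabilityMeasure μ] {n : ℕ} {X : ℕ → Ω → Fin n → ℝ} {Y ν : ℕ → Ω → ℝ}
    {B : Set (Fin n → ℝ)} {f : (Fin n → ℝ) → ℝ} {σ : ℝ} (hX : FeaturesIID μ X)
    (hY : NoisyResponses μ X Y ν B f σ) {i j : ℕ} (hij : i ≠ j)
    {E E' : Set (Fin n → ℝ)} {A A' : Set ℝ} (hE : MeasurableSet E) (hE' : MeasurableSet E')
    (hA : MeasurableSet A) (hA' : MeasurableSet A') :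
    μ.real ((X i ⁻¹' E ∩ ν i ⁻¹' A) ∩ (X j ⁻¹' E' ∩ ν j ⁻¹' A')) =
      μ.real (X i ⁻¹' E ∩ ν i ⁻¹' A) * μ.real (X j ⁻¹' E' ∩ ν j ⁻¹' A') := by
  let σX : ℕ → MeasurableSpace Ω := fun k => MeasurableSpace.comap (X k) inferInstance
  have hσX : ∀ k, σX k ≤ mΩ := fun k => (hX.measurable k).comap_le
  let m := max i j + 1
  let i' : Fin m := ⟨i, by omega⟩
  let j' : Fin m := ⟨j, by omega⟩
  have hij' : i' ≠ j' := by simpa [i', j', Fin.ext_iff] using hij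
  have hF : (⨆ k : Fin m, σX k) ≤ mΩ := iSup_le fun k => hσX k
  -- The other indices get the sure event, whose conditional probability is the constant one.
  let AA : Fin m → Set ℝ := fun k => if k = i' then A else if k = j' then A' else Set.univ
  have hAA : ∀ k, MeasurableSet (AA k) := fun k => by
    simp only [AA]; split_ifs <;> first | assumption | exact MeasurableSet.univ
  have hinter : (⋂ k : Fin m, ν k ⁻¹' AA k) = ν i ⁻¹' A ∩ ν j ⁻¹' A' := by
    ext ω
    simp only [Set.mem_iInter, Set.mem_preimage, Set.mem_inter_iff]
    constructor
    · intro h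
      have h1 := h i'
      have h2 := h j'
      simp only [AA, if_neg hij'.symm, if_true] at h1 h2
      exact ⟨h1, h2⟩
    · rintro ⟨h1, h2⟩ k
      simp only [AA]
      split_ifs with h h'
      · subst h; exact h1
      · subst h'; exact h2
      · trivial
  let a : Ω → ℝ := μ⟦ν i ⁻¹' A | σX i⟧
  let b : Ω → ℝ := μ⟦ν j ⁻¹' A' | σX j⟧
  have hprod : (fun ω => ∏ k : Fin m, (μ⟦ν k ⁻¹' AA k | σX k⟧) ω) = fun ω => a ω * b ω := by
    funext ω
    rw [Finset.prod_eq_mul i' j' hij']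
    · simp only [AA, if_neg hij'.symm, if_true]
      rfl
    · rintro k - ⟨h1, h2⟩
      simp only [AA, if_neg h1, if_neg h2, Set.preimage_univ, Set.indicator_univ]
      rw [condExp_const (hσX k)]
    · simp
    · simp
  have hcond := hY.condIndep m AA hAA
  rw [hinter, hprod] at hcond
  have hνA := hY.measurable i hA
  have hνA' := hY.measurable j hA'
  have hXE : MeasurableSet[σX i] (X i ⁻¹' E) := ⟨E, hE, rfl⟩
  have hXE' : MeasurableSet[σX j] (X j ⁻¹' E') := ⟨E', hE', rfl⟩
  have hFi : σX i ≤ ⨆ k : Fin m, σX k := le_iSup (fun k : Fin m => σX k) i'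
  have hFj : σX j ≤ ⨆ k : Fin m, σX k := le_iSup (fun k : Fin m => σX k) j'
  have h1 := setIntegral_condExp_indicator_one (μ := μ) hF
    ((hFi _ hXE).inter (hFj _ hXE')) (hνA.inter hνA')
  have h2 := setIntegral_condExp_indicator_one (μ := μ) (hσX i) hXE hνA
  have h3 := setIntegral_condExp_indicator_one (μ := μ) (hσX j) hXE' hνA'
  have hrw : (X i ⁻¹' E ∩ ν i ⁻¹' A) ∩ (X j ⁻¹' E' ∩ ν j ⁻¹' A') =
      (X i ⁻¹' E ∩ X j ⁻¹' E') ∩ (ν i ⁻¹' A ∩ ν j ⁻¹' A') := by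
    ext; simp only [Set.mem_inter_iff]; tauto
  rw [hrw, ← h1, ← h2, ← h3, ← integral_indicator (hσX i _ hXE),
    ← integral_indicator (hσX j _ hXE'),
    ← integral_indicator ((hσX i _ hXE).inter (hσX j _ hXE'))]
  have ha : StronglyMeasurable[σX i] ((X i ⁻¹' E).indicator a) :=
    stronglyMeasurable_condExp.indicator hXE
  have hb : StronglyMeasurable[σX j] ((X j ⁻¹' E').indicator b) :=
    stronglyMeasurable_condExp.indicator hXE'
  -- Each factor is measurable with respect to a single feature, so independence of the features
  -- splits the integral of the product.
  have hind : IndepFun ((X i ⁻¹' E).indicator a) ((X j ⁻¹' E').indicator b) μ := by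
    have : Indep (σX i) (σX j) μ := hX.indep.indepFun hij
    exact indep_of_indep_of_le_left
      (indep_of_indep_of_le_right this hb.measurable.comap_le) ha.measurable.comap_le
  have := hind.integral_mul_eq_mul_integral (ha.mono (hσX i)).aestronglyMeasurable
    (hb.mono (hσX j)).aestronglyMeasurable
  rw [← this]
  refine integral_congr_ae ?_
  filter_upwards [hcond] with ω hω
  simp only [Pi.mul_apply]
  by_cases h1 : ω ∈ X i ⁻¹' E <;> by_cases h2 : ω ∈ X j ⁻¹' E' <;>
    simp [Set.indicator, h1, h2, -Set.mem_preimage]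
  exact hω

/-- The pairs `(X i, ν i)` are pairwise independent. -/
theorem NoisyResponses.indepFun_pair {Ω : Type*} [MeasurableSpace Ω] {μ : Measure Ω}
    [IsProbabilityMeasure μ] {n : ℕ} {X : ℕ → Ω → Fin n → ℝ} {Y ν : ℕ → Ω → ℝ}
    {B : Set (Fin n → ℝ)} {f : (Fin n → ℝ) → ℝ} {σ : ℝ} (hX : FeaturesIID μ X)
    (hY : NoisyResponses μ X Y ν B f σ) {i j : ℕ} (hij : i ≠ j) :
    IndepFun (fun ω => (X i ω, ν i ω)) (fun ω => (X j ω, ν j ω)) μ := by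
  have hmeas : ∀ k, Measurable fun ω => (X k ω, ν k ω) := fun k =>
    (hX.measurable k).prodMk (hY.measurable k)
  let R : Set (Set ((Fin n → ℝ) × ℝ)) :=
    Set.image2 (· ×ˢ ·) {s | MeasurableSet s} {t | MeasurableSet t}
  have hR : IsPiSystem R := isPiSystem_prod
  have hgen : ∀ k, MeasurableSpace.comap (fun ω => (X k ω, ν k ω)) inferInstance =
      MeasurableSpace.generateFrom {s | ∃ t ∈ R, (fun ω => (X k ω, ν k ω)) ⁻¹' t = s} := by
    intro k
    rw [show (inferInstance : MeasurableSpace ((Fin n → ℝ) × ℝ)) =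
      MeasurableSpace.generateFrom R from generateFrom_prod.symm,
      MeasurableSpace.comap_generateFrom]
    rfl
  refine IndepSets.indep (hmeas i).comap_le (hmeas j).comap_le (hR.comap _) (hR.comap _)
    (hgen i) (hgen j) ?_
  rw [IndepSets_iff]
  rintro _ _ ⟨_, ⟨E, hE, A, hA, rfl⟩, rfl⟩ ⟨_, ⟨E', hE', A', hA', rfl⟩, rfl⟩
  have := NoisyResponses.measure_rectangles hX hY hij hE hE' hA hA'
  rw [← ENNReal.toReal_eq_toReal_iff' (measure_ne_top _ _) (by finiteness), ENNReal.toReal_mul]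
  exact this

/-! ### Bernstein polynomials in one variable -/

theorem bernsteinPolynomial_eval_nonneg (N k : ℕ) {s : ℝ} (h0 : 0 ≤ s) (h1 : s ≤ 1) :
    0 ≤ (bernsteinPolynomial ℝ N k).eval s := by
  have : 0 ≤ 1 - s := by linarith
  simp only [bernsteinPolynomial, Polynomial.eval_mul, Polynomial.eval_natCast,
    Polynomial.eval_pow, Polynomial.eval_X, Polynomial.eval_sub, Polynomial.eval_one]
  positivity

theorem bernsteinPolynomial_sum_eval (N : ℕ) (s : ℝ) :
    ∑ k ∈ Finset.range (N + 1), (bernsteinPolynomial ℝ N k).eval s = 1 := by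
  have := congrArg (Polynomial.eval s) (bernsteinPolynomial.sum ℝ N)
  simpa [Polynomial.eval_finsetSum] using this

theorem bernsteinPolynomial_variance_eval_le {N : ℕ} (hN : N ≠ 0) (s : ℝ) :
    ∑ k ∈ Finset.range (N + 1), (bernsteinPolynomial ℝ N k).eval s * (k / N - s) ^ 2 ≤
      1 / (4 * N) := by
  have := congrArg (Polynomial.eval s) (bernsteinPolynomial.variance ℝ N)
  simp only [Polynomial.eval_finsetSum, Polynomial.eval_mul, Polynomial.eval_pow,
    Polynomial.eval_sub, Polynomial.eval_natCast, Polynomial.eval_X, Polynomial.eval_one,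
    nsmul_eq_mul] at this
  have hN' : (0 : ℝ) < N := by positivity
  have e : ∑ k ∈ Finset.range (N + 1), (bernsteinPolynomial ℝ N k).eval s * (k / N - s) ^ 2 =
      N * s * (1 - s) / N ^ 2 := by
    rw [← this, Finset.sum_div]
    refine Finset.sum_congr rfl fun k _ => ?_
    field_simp
    ring
  rw [e, div_le_div_iff₀ (by positivity) (by positivity)]
  nlinarith [mul_nonneg (sq_nonneg (N : ℝ)) (sq_nonneg (2 * s - 1))]

/-- Summation by parts moves the difference of basis polynomials onto the coefficients. The
derivative is thus a convex combination of scaled increments, which is why slope bounds survive. -/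
theorem derivative_bernstein_sum (N : ℕ) (a : ℕ → ℝ) :
    Polynomial.derivative
      (∑ k ∈ Finset.range (N + 2), Polynomial.C (a k) * bernsteinPolynomial ℝ (N + 1) k) =
      ∑ k ∈ Finset.range (N + 1),
        Polynomial.C ((N + 1) * (a (k + 1) - a k)) * bernsteinPolynomial ℝ N k := by
  have key : ∑ k ∈ Finset.range (N + 1),
        Polynomial.C (a (k + 1)) * bernsteinPolynomial ℝ N (k + 1) +
        Polynomial.C (a 0) * bernsteinPolynomial ℝ N 0 =
      ∑ k ∈ Finset.range (N + 1), Polynomial.C (a k) * bernsteinPolynomial ℝ N k := by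
    rw [← Finset.sum_range_succ' (fun k => Polynomial.C (a k) * bernsteinPolynomial ℝ N k),
      Finset.sum_range_succ, bernsteinPolynomial.eq_zero_of_lt ℝ (Nat.lt_succ_self N)]
    simp
  rw [Finset.sum_range_succ', Polynomial.derivative_add, Polynomial.derivative_sum]
  simp only [Polynomial.derivative_C_mul, bernsteinPolynomial.derivative_succ_aux,
    bernsteinPolynomial.derivative_zero, Nat.add_sub_cancel, Nat.cast_add, Nat.cast_one]
  have e1 : ∀ k, Polynomial.C (a (k + 1)) * (((N : Polynomial ℝ) + 1) *
      (bernsteinPolynomial ℝ N k - bernsteinPolynomial ℝ N (k + 1))) =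
      ((N : Polynomial ℝ) + 1) * (Polynomial.C (a (k + 1)) * bernsteinPolynomial ℝ N k) -
      ((N : Polynomial ℝ) + 1) * (Polynomial.C (a (k + 1)) * bernsteinPolynomial ℝ N (k + 1)) :=
    fun k => by ring
  have e2 : ∀ k, Polynomial.C (((N : ℝ) + 1) * (a (k + 1) - a k)) * bernsteinPolynomial ℝ N k =
      ((N : Polynomial ℝ) + 1) * (Polynomial.C (a (k + 1)) * bernsteinPolynomial ℝ N k) -
      ((N : Polynomial ℝ) + 1) * (Polynomial.C (a k) * bernsteinPolynomial ℝ N k) := fun k => by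
    simp only [Polynomial.C_mul, Polynomial.C_add, Polynomial.C_sub, Polynomial.C_1,
      Polynomial.C_eq_natCast]
    ring
  simp only [e1, e2, Finset.sum_sub_distrib, ← Finset.mul_sum]
  rw [← key]
  ring

/-- If the increments of `a` are between `c / N` and `c' / N`, then so are the slopes of the
Bernstein polynomial with coefficients `a`, up to the factor `N`. -/
theorem bernstein_sum_slope {N : ℕ} (a : ℕ → ℝ) {c c' : ℝ}
    (hc : ∀ k ≤ N, c ≤ (N + 1) * (a (k + 1) - a k))
    (hc' : ∀ k ≤ N, (N + 1) * (a (k + 1) - a k) ≤ c') {s t : ℝ} (hs : 0 ≤ s) (hst : s ≤ t)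
    (ht : t ≤ 1) :
    let P := ∑ k ∈ Finset.range (N + 2), Polynomial.C (a k) * bernsteinPolynomial ℝ (N + 1) k
    c * (t - s) ≤ P.eval t - P.eval s ∧ P.eval t - P.eval s ≤ c' * (t - s) := by
  intro P
  have hd : ∀ r, deriv (fun x => P.eval x) r = ∑ k ∈ Finset.range (N + 1),
      ((N + 1) * (a (k + 1) - a k)) * (bernsteinPolynomial ℝ N k).eval r := fun r => by
    rw [Polynomial.deriv, derivative_bernstein_sum, Polynomial.eval_finsetSum]
    simp only [Polynomial.eval_mul, Polynomial.eval_C]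
  have hlo : ∀ r ∈ interior (Set.Icc (0 : ℝ) 1), c ≤ deriv (fun x => P.eval x) r := by
    intro r hr
    have hr := interior_subset hr
    have e : c = ∑ k ∈ Finset.range (N + 1), c * (bernsteinPolynomial ℝ N k).eval r := by
      rw [← Finset.mul_sum, bernsteinPolynomial_sum_eval, mul_one]
    rw [hd, e]
    refine Finset.sum_le_sum fun k hk => mul_le_mul_of_nonneg_right
      (hc k (Nat.lt_succ_iff.1 (Finset.mem_range.1 hk)))
      (bernsteinPolynomial_eval_nonneg N k hr.1 hr.2)
  have hhi : ∀ r ∈ interior (Set.Icc (0 : ℝ) 1), deriv (fun x => P.eval x) r ≤ c' := by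
    intro r hr
    have hr := interior_subset hr
    have e : c' = ∑ k ∈ Finset.range (N + 1), c' * (bernsteinPolynomial ℝ N k).eval r := by
      rw [← Finset.mul_sum, bernsteinPolynomial_sum_eval, mul_one]
    rw [hd, e]
    refine Finset.sum_le_sum fun k hk => mul_le_mul_of_nonneg_right
      (hc' k (Nat.lt_succ_iff.1 (Finset.mem_range.1 hk)))
      (bernsteinPolynomial_eval_nonneg N k hr.1 hr.2)
  have hs' : s ∈ Set.Icc (0 : ℝ) 1 := ⟨hs, hst.trans ht⟩
  have ht' : t ∈ Set.Icc (0 : ℝ) 1 := ⟨hs.trans hst, ht⟩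
  exact ⟨(convex_Icc 0 1).mul_sub_le_image_sub_of_le_deriv P.continuous.continuousOn
      P.differentiable.differentiableOn hlo s hs' t ht' hst,
    (convex_Icc 0 1).image_sub_le_mul_sub_of_deriv_le P.continuous.continuousOn
      P.differentiable.differentiableOn hhi s hs' t ht' hst⟩

/-- The weights form the law of a binomial proportion, with variance at most `1 / (4 * N)`. The
inequality `L * r ≤ ε + L ^ 2 * r ^ 2 / (4 * ε)` reduces the mean deviation to this variance. -/
theorem bernstein_sum_error {N : ℕ} (hN : N ≠ 0) (a : ℕ → ℝ) {s v L ε : ℝ} (hε : 0 < ε)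
    (hs0 : 0 ≤ s) (hs1 : s ≤ 1)
    (ha : ∀ k ≤ N, |a k - v| ≤ L * |(k : ℝ) / N - s|) :
    |∑ k ∈ Finset.range (N + 1), (bernsteinPolynomial ℝ N k).eval s * a k - v| ≤
      ε + L ^ 2 / (16 * ε * N) := by
  have hb := fun k => bernsteinPolynomial_eval_nonneg N k hs0 hs1
  have hsum := bernsteinPolynomial_sum_eval N s
  calc |∑ k ∈ Finset.range (N + 1), (bernsteinPolynomial ℝ N k).eval s * a k - v|
      = |∑ k ∈ Finset.range (N + 1), (bernsteinPolynomial ℝ N k).eval s * (a k - v)| := by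
        simp only [mul_sub, Finset.sum_sub_distrib, ← Finset.sum_mul, hsum, one_mul]
    _ ≤ ∑ k ∈ Finset.range (N + 1), |(bernsteinPolynomial ℝ N k).eval s * (a k - v)| :=
        Finset.abs_sum_le_sum_abs _ _
    _ ≤ ∑ k ∈ Finset.range (N + 1), ((bernsteinPolynomial ℝ N k).eval s * ε +
          L ^ 2 / (4 * ε) * ((bernsteinPolynomial ℝ N k).eval s * ((k : ℝ) / N - s) ^ 2)) := by
        refine Finset.sum_le_sum fun k hk => ?_
        rw [abs_mul, abs_of_nonneg (hb k)]
        have h1 := ha k (Nat.lt_succ_iff.1 (Finset.mem_range.1 hk))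
        have h2 : L * |(k : ℝ) / N - s| ≤ ε + L ^ 2 / (4 * ε) * ((k : ℝ) / N - s) ^ 2 := by
          rw [← sq_abs ((k : ℝ) / N - s), ← sub_nonneg]
          have : ε + L ^ 2 / (4 * ε) * |(k : ℝ) / N - s| ^ 2 - L * |(k : ℝ) / N - s| =
            (2 * ε - L * |(k : ℝ) / N - s|) ^ 2 / (4 * ε) := by field_simp; ring
          rw [this]; positivity
        calc _ ≤ (bernsteinPolynomial ℝ N k).eval s *
              (ε + L ^ 2 / (4 * ε) * ((k : ℝ) / N - s) ^ 2) :=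
            mul_le_mul_of_nonneg_left (h1.trans h2) (hb k)
          _ = _ := by ring
    _ ≤ ε + L ^ 2 / (4 * ε) * (1 / (4 * N)) := by
        rw [Finset.sum_add_distrib, ← Finset.sum_mul, hsum, ← Finset.mul_sum, one_mul]
        gcongr
        exact bernsteinPolynomial_variance_eval_le hN s
    _ = _ := by field_simp; ring

/-! ### Slope bounds on a box -/

noncomputable section

/-- The slopes of `g` along segments of the box `[l, u]` which are parallel to the `i`-th axis are
between `Kminus i` and `Kplus i`. -/
def SlopeBounded {n : ℕ} (Kminus Kplus l u : Fin n → ℝ) (g : (Fin n → ℝ) → ℝ) : Prop :=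
  ∀ x ∈ box l u, ∀ i, ∀ s t, l i ≤ s → s ≤ t → t ≤ u i →
    Kminus i * (t - s) ≤ g (Function.update x i t) - g (Function.update x i s) ∧
      g (Function.update x i t) - g (Function.update x i s) ≤ Kplus i * (t - s)

end

theorem box_eq_pi {n : ℕ} (l u : Fin n → ℝ) :
    box l u = Set.univ.pi fun i => Set.Icc (l i) (u i) := by
  ext x; simp only [box, Set.mem_pi, Set.mem_univ, true_imp_iff, Set.mem_Icc, Set.mem_ofPred_eq]

theorem update_mem_box {n : ℕ} {l u x : Fin n → ℝ} (hx : x ∈ box l u) (i : Fin n) {t : ℝ}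
    (h1 : l i ≤ t) (h2 : t ≤ u i) : Function.update x i t ∈ box l u := by
  intro j
  rcases eq_or_ne j i with rfl | hj
  · simpa using ⟨h1, h2⟩
  · simpa [hj] using hx j

theorem isCompact_box {n : ℕ} (l u : Fin n → ℝ) : IsCompact (box l u) := by
  rw [box_eq_pi]; exact isCompact_univ_pi fun i => isCompact_Icc

theorem hasDerivWithinAt_update_of_box {n : ℕ} {l u : Fin n → ℝ} {g : (Fin n → ℝ) → ℝ}
    (hg : DifferentiableOn ℝ g (box l u)) {x : Fin n → ℝ} (hx : x ∈ box l u) (i : Fin n) {t : ℝ}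
    (ht : t ∈ Set.Icc (l i) (u i)) :
    HasDerivWithinAt (fun s => g (Function.update x i s))
      (fderivWithin ℝ g (box l u) (Function.update x i t) (Pi.single i 1))
      (Set.Icc (l i) (u i)) t :=
  ((hg _ (update_mem_box hx i ht.1 ht.2)).hasFDerivWithinAt).comp_hasDerivWithinAt t
    (hasDerivAt_update x i t).hasDerivWithinAt fun _ hs => update_mem_box hx i hs.1 hs.2

/-- Slope bounds are the derivative-free form of the constraint: they pass directly to finite
differences and convex combinations, as Bernstein operators require. -/
theorem HasKBoundedDerivatives.slopeBounded {n : ℕ} {Kminus Kplus l u : Fin n → ℝ}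
    {g : (Fin n → ℝ) → ℝ} (hg : HasKBoundedDerivatives Kminus Kplus (box l u) g) :
    SlopeBounded Kminus Kplus l u g := by
  intro x hx i s t hs hst ht
  have hd := fun r (hr : r ∈ Set.Icc (l i) (u i)) =>
    hasDerivWithinAt_update_of_box (hg.1.differentiableOn one_ne_zero) hx i hr
  have hcont : ContinuousOn (fun s => g (Function.update x i s)) (Set.Icc (l i) (u i)) :=
    fun r hr => (hd r hr).continuousWithinAt
  have hdiff : DifferentiableOn ℝ (fun s => g (Function.update x i s))
      (interior (Set.Icc (l i) (u i))) :=
    fun r hr => ((hd r (interior_subset hr)).mono interior_subset).differentiableWithinAt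
  have hderiv : ∀ r ∈ interior (Set.Icc (l i) (u i)),
      deriv (fun s => g (Function.update x i s)) r =
        fderivWithin ℝ g (box l u) (Function.update x i r) (Pi.single i 1) := fun r hr =>
    ((hd r (interior_subset hr)).hasDerivAt (mem_interior_iff_mem_nhds.1 hr)).deriv
  have hb := fun r (hr : r ∈ interior (Set.Icc (l i) (u i))) =>
    hg.2 i _ (update_mem_box hx i (interior_subset hr).1 (interior_subset hr).2)
  exact ⟨(convex_Icc _ _).mul_sub_le_image_sub_of_le_deriv hcont hdiff
      (fun r hr => by rw [hderiv r hr]; exact (hb r hr).1) s ⟨hs, hst.trans ht⟩ t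
      ⟨hs.trans hst, ht⟩ hst,
    (convex_Icc _ _).image_sub_le_mul_sub_of_deriv_le hcont hdiff
      (fun r hr => by rw [hderiv r hr]; exact (hb r hr).2) s ⟨hs, hst.trans ht⟩ t
      ⟨hs.trans hst, ht⟩ hst⟩

/-- Subtracting the linear function of slope `Kminus i` leaves a monotone function along the axis,
whose derivative within the interval is nonnegative, even at an endpoint; likewise for `Kplus i`. -/
theorem SlopeBounded.hasKBoundedDerivatives {n : ℕ} {Kminus Kplus l u : Fin n → ℝ}
    (hlu : ∀ i, l i < u i) {g : (Fin n → ℝ) → ℝ} (hg : SlopeBounded Kminus Kplus l u g)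
    (hsmooth : ContDiffOn ℝ 1 g (box l u)) :
    HasKBoundedDerivatives Kminus Kplus (box l u) g := by
  refine ⟨hsmooth, fun i x hx => ?_⟩
  have hd := hasDerivWithinAt_update_of_box (hsmooth.differentiableOn one_ne_zero) hx i (hx i)
  rw [Function.update_eq_self] at hd
  have hu := uniqueDiffOn_Icc (hlu i) (x i) (hx i)
  constructor
  · have h1 := hd.sub ((hasDerivWithinAt_id (x i) (Set.Icc (l i) (u i))).const_mul (Kminus i))
    have h2 : MonotoneOn ((fun s => g (Function.update x i s)) - fun s => Kminus i * id s)
        (Set.Icc (l i) (u i)) := fun s hs t ht hst => by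
      have := (hg x hx i s t hs.1 hst ht.2).1
      simp only [Pi.sub_apply, id]; linarith
    have := h2.derivWithin_nonneg (x := x i)
    erw [h1.derivWithin hu] at this
    linarith
  · have h1 := ((hasDerivWithinAt_id (x i) (Set.Icc (l i) (u i))).const_mul (Kplus i)).sub hd
    have h2 : MonotoneOn ((fun s => Kplus i * id s) - fun s => g (Function.update x i s))
        (Set.Icc (l i) (u i)) := fun s hs t ht hst => by
      have := (hg x hx i s t hs.1 hst ht.2).2
      simp only [Pi.sub_apply, id]; linarith
    have := h2.derivWithin_nonneg (x := x i)
    erw [h1.derivWithin hu] at this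
    linarith

theorem SlopeBounded.abs_update_sub_le {n : ℕ} {Kminus Kplus l u : Fin n → ℝ}
    {g : (Fin n → ℝ) → ℝ} (hg : SlopeBounded Kminus Kplus l u g) {x : Fin n → ℝ}
    (hx : x ∈ box l u) (i : Fin n) {s t : ℝ} (hs : s ∈ Set.Icc (l i) (u i))
    (ht : t ∈ Set.Icc (l i) (u i)) :
    |g (Function.update x i t) - g (Function.update x i s)| ≤
      max |Kminus i| |Kplus i| * |t - s| := by
  wlog hst : s ≤ t generalizing s t
  · rw [abs_sub_comm, abs_sub_comm t s]
    exact this ht hs (le_of_not_ge hst)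
  obtain ⟨h1, h2⟩ := hg x hx i s t hs.1 hst ht.2
  have h0 : 0 ≤ t - s := sub_nonneg.2 hst
  rw [abs_of_nonneg h0, abs_le]
  have h3 : -max |Kminus i| |Kplus i| ≤ Kminus i :=
    (neg_le_neg (le_max_left _ _)).trans (neg_abs_le _)
  have h4 : Kplus i ≤ max |Kminus i| |Kplus i| := (le_abs_self _).trans (le_max_right _ _)
  constructor
  · nlinarith [mul_le_mul_of_nonneg_right h3 h0]
  · nlinarith [mul_le_mul_of_nonneg_right h4 h0]

/-- A common Lipschitz constant, for the maximum norm, of the functions with slopes between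
`Kminus` and `Kplus`. -/
theorem SlopeBounded.abs_sub_le {n : ℕ} {Kminus Kplus l u : Fin n → ℝ}
    {g : (Fin n → ℝ) → ℝ} (hg : SlopeBounded Kminus Kplus l u g) {x y : Fin n → ℝ}
    (hx : x ∈ box l u) (hy : y ∈ box l u) :
    |g x - g y| ≤ (∑ i, max |Kminus i| |Kplus i|) * dist x y := by
  -- The coordinates of `y` are replaced by those of `x` one at a time; a box contains all the
  -- intermediate points.
  have key : ∀ S : Finset (Fin n), S.piecewise x y ∈ box l u ∧
      |g (S.piecewise x y) - g y| ≤ ∑ i ∈ S, max |Kminus i| |Kplus i| * dist x y := by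
    intro S
    induction S using Finset.induction_on with
    | empty => simpa using hy
    | insert i S hi ih =>
      obtain ⟨hmem, hle⟩ := ih
      rw [Finset.piecewise_insert, Finset.sum_insert hi]
      refine ⟨update_mem_box hmem i (hx i).1 (hx i).2, ?_⟩
      have h1 := hg.abs_update_sub_le hmem i (hmem i) (hx i)
      rw [Function.update_eq_self, Finset.piecewise_eq_of_notMem _ _ _ hi] at h1
      have h2 : |x i - y i| ≤ dist x y := dist_le_pi_dist x y i
      have h3 : max |Kminus i| |Kplus i| * |x i - y i| ≤ max |Kminus i| |Kplus i| * dist x y := by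
        gcongr
      calc _ ≤ _ := _root_.abs_sub_le _ (g (S.piecewise x y)) _
        _ ≤ _ := add_le_add (h1.trans h3) hle
  have := (key Finset.univ).2
  rwa [Finset.piecewise_univ, ← Finset.sum_mul] at this

/-! ### Polynomial approximation preserving slope bounds -/

noncomputable section

/-- The Bernstein operator of degree `N` acting in the `i`-th coordinate, on the box `[l, u]`. -/
def coordBernstein {n : ℕ} (l u : Fin n → ℝ) (N : ℕ) (i : Fin n) (g : (Fin n → ℝ) → ℝ)
    (x : Fin n → ℝ) : ℝ :=
  ∑ k ∈ Finset.range (N + 1), (bernsteinPolynomial ℝ N k).eval ((x i - l i) / (u i - l i)) *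
    g (Function.update x i (l i + (u i - l i) * (k / N)))

end

theorem bernstein_node_mem {a b : ℝ} (hab : a < b) {N k : ℕ} (hk : k ≤ N) :
    a + (b - a) * ((k : ℝ) / N) ∈ Set.Icc a b := by
  have h1 : (k : ℝ) / N ≤ 1 := div_le_one_of_le₀ (by exact_mod_cast hk) (by positivity)
  have h0 : 0 ≤ (k : ℝ) / N := by positivity
  have := sub_pos.2 hab
  constructor <;> nlinarith

/-- Along axis `i` this is the one-variable slope estimate, applied to the values of `g` at the
nodes. Along any other axis the operator is a convex combination of slices of `g`, each with the
same bounds. -/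
theorem SlopeBounded.coordBernstein {n : ℕ} {Kminus Kplus l u : Fin n → ℝ}
    (hlu : ∀ i, l i < u i) {g : (Fin n → ℝ) → ℝ} (hg : SlopeBounded Kminus Kplus l u g)
    (N : ℕ) (i : Fin n) :
    SlopeBounded Kminus Kplus l u (coordBernstein l u (N + 1) i g) := by
  intro x hx j s t hs hst ht
  have hlui : 0 < u i - l i := sub_pos.2 (hlu i)
  rcases eq_or_ne j i with rfl | hj
  · let a : ℕ → ℝ := fun k =>
      g (Function.update x j (l j + (u j - l j) * ((k : ℝ) / ((N + 1 : ℕ) : ℝ))))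
    have hval : ∀ r, _root_.coordBernstein l u (N + 1) j g (Function.update x j r) =
        (∑ k ∈ Finset.range (N + 2),
          Polynomial.C (a k) * bernsteinPolynomial ℝ (N + 1) k).eval ((r - l j) / (u j - l j)) := by
      intro r
      rw [Polynomial.eval_finsetSum]
      refine Finset.sum_congr rfl fun k _ => ?_
      simp only [Function.update_self, Function.update_idem, Polynomial.eval_mul,
        Polynomial.eval_C, a]
      ring
    have hstep : ∀ k ≤ N, Kminus j * (u j - l j) ≤ (N + 1) * (a (k + 1) - a k) ∧
        (N + 1) * (a (k + 1) - a k) ≤ Kplus j * (u j - l j) := by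
      intro k hk
      have h1 := bernstein_node_mem (hlu j) (show k ≤ N + 1 by omega)
      have h2 := bernstein_node_mem (hlu j) (show k + 1 ≤ N + 1 by omega)
      have hN : (0 : ℝ) < N + 1 := by positivity
      have hdiff : l j + (u j - l j) * (((k + 1 : ℕ) : ℝ) / ((N + 1 : ℕ) : ℝ)) -
          (l j + (u j - l j) * ((k : ℝ) / ((N + 1 : ℕ) : ℝ))) = (u j - l j) / (N + 1) := by
        push_cast; field_simp; ring
      have hpos : 0 < (u j - l j) / ((N : ℝ) + 1) := by positivity
      obtain ⟨h3, h4⟩ := hg x hx j _ _ h1.1 (by linarith) h2.2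
      rw [hdiff] at h3 h4
      constructor
      · calc _ = (N + 1) * (Kminus j * ((u j - l j) / ((N : ℝ) + 1))) := by field_simp
          _ ≤ _ := mul_le_mul_of_nonneg_left h3 hN.le
      · calc _ ≤ (N + 1) * (Kplus j * ((u j - l j) / ((N : ℝ) + 1))) :=
              mul_le_mul_of_nonneg_left h4 hN.le
          _ = _ := by field_simp
    have := bernstein_sum_slope a (fun k hk => (hstep k hk).1) (fun k hk => (hstep k hk).2)
      (s := (s - l j) / (u j - l j)) (t := (t - l j) / (u j - l j))
      (div_nonneg (by linarith) hlui.le) (by gcongr) (by rw [div_le_one hlui]; linarith)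
    rw [hval, hval]
    have e : ∀ K : ℝ, K * (u j - l j) * ((t - l j) / (u j - l j) - (s - l j) / (u j - l j)) =
        K * (t - s) := fun K => by field_simp; ring
    simpa only [e] using this
  · let w : ℕ → ℝ := fun k => (bernsteinPolynomial ℝ (N + 1) k).eval ((x i - l i) / (u i - l i))
    have hw : ∀ k, 0 ≤ w k := fun k => bernsteinPolynomial_eval_nonneg _ _
      (div_nonneg (sub_nonneg.2 (hx i).1) hlui.le)
      (by rw [div_le_one hlui]; linarith [(hx i).2])
    have hw1 : ∑ k ∈ Finset.range (N + 1 + 1), w k = 1 := bernsteinPolynomial_sum_eval _ _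
    let z : ℕ → Fin n → ℝ := fun k =>
      Function.update x i (l i + (u i - l i) * ((k : ℝ) / ((N + 1 : ℕ) : ℝ)))
    have hdiff : _root_.coordBernstein l u (N + 1) i g (Function.update x j t) -
        _root_.coordBernstein l u (N + 1) i g (Function.update x j s) =
        ∑ k ∈ Finset.range (N + 1 + 1),
          w k * (g (Function.update (z k) j t) - g (Function.update (z k) j s)) := by
      simp only [_root_.coordBernstein, ← Finset.sum_sub_distrib, ← mul_sub,
        Function.update_of_ne hj.symm, w, z]
      refine Finset.sum_congr rfl fun k _ => ?_
      rw [Function.update_comm hj, Function.update_comm hj]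
    have hb : ∀ k ∈ Finset.range (N + 1 + 1), _ := fun k hk =>
      have hk := bernstein_node_mem (hlu i) (Nat.lt_succ_iff.1 (Finset.mem_range.1 hk))
      hg (z k) (update_mem_box hx i hk.1 hk.2) j s t hs hst ht
    have e : ∀ K : ℝ, K * (t - s) = ∑ k ∈ Finset.range (N + 1 + 1), w k * (K * (t - s)) :=
      fun K => by rw [← Finset.sum_mul, hw1, one_mul]
    rw [hdiff, e (Kminus j), e (Kplus j)]
    exact ⟨Finset.sum_le_sum fun k hk => mul_le_mul_of_nonneg_left (hb k hk).1 (hw k),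
      Finset.sum_le_sum fun k hk => mul_le_mul_of_nonneg_left (hb k hk).2 (hw k)⟩

theorem SlopeBounded.exists_coordBernstein_close {n : ℕ} {Kminus Kplus l u : Fin n → ℝ}
    (hlu : ∀ i, l i < u i) {g : (Fin n → ℝ) → ℝ} (hg : SlopeBounded Kminus Kplus l u g)
    (i : Fin n) {ε : ℝ} (hε : 0 < ε) :
    ∃ N : ℕ, ∀ x ∈ box l u, |_root_.coordBernstein l u (N + 1) i g x - g x| ≤ ε := by
  have hlui : 0 < u i - l i := sub_pos.2 (hlu i)
  -- The side length enters because the nodes are rescaled to the unit interval.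
  set L := max |Kminus i| |Kplus i| * (u i - l i)
  obtain ⟨N, hN⟩ := exists_nat_gt (L ^ 2 / (16 * (ε / 2)) / (ε / 2))
  refine ⟨N, fun x hx => ?_⟩
  have h := bernstein_sum_error (N := N + 1) (Nat.succ_ne_zero N)
    (fun k => g (Function.update x i (l i + (u i - l i) * ((k : ℝ) / ((N + 1 : ℕ) : ℝ)))))
    (s := (x i - l i) / (u i - l i)) (v := g x) (L := L) (half_pos hε)
    (div_nonneg (sub_nonneg.2 (hx i).1) hlui.le)
    (by rw [div_le_one hlui]; linarith [(hx i).2]) (fun k hk => ?_)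
  · refine h.trans ?_
    have hN' : L ^ 2 / (16 * (ε / 2)) / (ε / 2) < ((N + 1 : ℕ) : ℝ) := by
      push_cast; linarith
    have : L ^ 2 / (16 * (ε / 2) * ((N + 1 : ℕ) : ℝ)) ≤ ε / 2 := by
      rw [← div_div, div_le_iff₀ (by positivity)]
      rw [div_lt_iff₀ (half_pos hε)] at hN'
      linarith
    linarith
  · have h1 := hg.abs_update_sub_le hx i (hx i) (bernstein_node_mem (hlu i) hk)
    rw [Function.update_eq_self] at h1
    refine h1.trans (le_of_eq ?_)
    have : l i + (u i - l i) * ((k : ℝ) / ((N + 1 : ℕ) : ℝ)) - x i =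
        (u i - l i) * ((k : ℝ) / ((N + 1 : ℕ) : ℝ) - (x i - l i) / (u i - l i)) := by
      field_simp; ring
    rw [this, abs_mul, abs_of_pos hlui, ← mul_assoc]

/-- Functions with bounded slopes on a box are uniform limits of polynomials with the same bounds
on the slopes. -/
theorem SlopeBounded.exists_mvPolynomial_close {n : ℕ} {Kminus Kplus l u : Fin n → ℝ}
    (hlu : ∀ i, l i < u i) {f : (Fin n → ℝ) → ℝ} (hf : SlopeBounded Kminus Kplus l u f)
    {ε : ℝ} (hε : 0 < ε) :
    ∃ p : MvPolynomial (Fin n) ℝ, SlopeBounded Kminus Kplus l u (fun x => MvPolynomial.eval x p) ∧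
      ∀ x ∈ box l u, |MvPolynomial.eval x p - f x| ≤ ε := by
  -- Invariant: `g` is polynomial in the coordinates of `S` once the others are frozen at `y`. It is
  -- trivial for the empty set and is the goal for the full set.
  have key : ∀ (δ : ℝ), 0 < δ → ∀ S : Finset (Fin n), ∃ g : (Fin n → ℝ) → ℝ,
      SlopeBounded Kminus Kplus l u g ∧ (∀ x ∈ box l u, |g x - f x| ≤ S.card * δ) ∧
      ∀ y, ∃ p : MvPolynomial (Fin n) ℝ, ∀ x, g (S.piecewise x y) = MvPolynomial.eval x p := by
    intro δ hδ S
    induction S using Finset.induction_on with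
    | empty => exact ⟨f, hf, fun x _ => by simp, fun y => ⟨MvPolynomial.C (f y), by simp⟩⟩
    | insert i S hi ih =>
      obtain ⟨g, hg, hgf, hpoly⟩ := ih
      obtain ⟨N, hN⟩ := hg.exists_coordBernstein_close hlu i hδ
      refine ⟨_root_.coordBernstein l u (N + 1) i g, hg.coordBernstein hlu N i,
        fun x hx => ?_, fun y => ?_⟩
      · rw [Finset.card_insert_of_notMem hi]
        have := _root_.abs_sub_le (_root_.coordBernstein l u (N + 1) i g x) (g x) (f x)
        push_cast
        linarith [hN x hx, hgf x hx]
      · choose p hp using fun k : ℕ => hpoly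
          (Function.update y i (l i + (u i - l i) * ((k : ℝ) / ((N + 1 : ℕ) : ℝ))))
        refine ⟨∑ k ∈ Finset.range (N + 1 + 1), Polynomial.aeval
          ((MvPolynomial.X i - MvPolynomial.C (l i)) * MvPolynomial.C (u i - l i)⁻¹)
          (bernsteinPolynomial ℝ (N + 1) k) * p k, fun x => ?_⟩
        rw [map_sum]
        refine Finset.sum_congr rfl fun k _ => ?_
        rw [map_mul, ← hp]
        congr 1
        · have := Polynomial.aeval_algHom_apply
            (MvPolynomial.aeval x : MvPolynomial (Fin n) ℝ →ₐ[ℝ] ℝ)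
            ((MvPolynomial.X i - MvPolynomial.C (l i)) * MvPolynomial.C (u i - l i)⁻¹)
            (bernsteinPolynomial ℝ (N + 1) k)
          rw [← MvPolynomial.coe_aeval_eq_eval, RingHom.coe_coe, ← this]
          simp [div_eq_mul_inv]
        · congr 1
          funext j
          rcases eq_or_ne j i with rfl | hj
          · simp [hi]
          · by_cases hjS : j ∈ S <;> simp [hj, hjS]
  have hn : (0 : ℝ) < n + 1 := by positivity
  -- The denominator `n + 1` also covers dimension zero.
  obtain ⟨g, hg, hgf, hpoly⟩ := key (ε / (n + 1)) (by positivity) Finset.univ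
  obtain ⟨p, hp⟩ := hpoly 0
  simp only [Finset.piecewise_univ] at hp
  have : (fun x => MvPolynomial.eval x p) = g := funext fun x => (hp x).symm
  refine ⟨p, by rwa [this], fun x hx => ?_⟩
  rw [← hp x]
  refine (hgf x hx).trans ?_
  rw [Finset.card_univ, Fintype.card_fin, mul_div_assoc', div_le_iff₀ hn]
  nlinarith

theorem contDiff_mvPolynomial_eval {n : ℕ} (p : MvPolynomial (Fin n) ℝ) :
    ContDiff ℝ 1 fun x : Fin n → ℝ => MvPolynomial.eval x p := by
  induction p using MvPolynomial.induction_on with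
  | C a => simpa using contDiff_const
  | add p q hp hq => simpa using hp.add hq
  | mul_X p i hp => simpa using hp.mul (contDiff_apply ℝ ℝ i)

theorem HasKBoundedDerivatives.exists_feasiblePolynomials_close {n : ℕ}
    {Kminus Kplus l u : Fin n → ℝ} (hlu : ∀ i, l i < u i) {f : (Fin n → ℝ) → ℝ}
    (hf : HasKBoundedDerivatives Kminus Kplus (box l u) f) {ε : ℝ} (hε : 0 < ε) :
    ∃ (D : ℕ) (q : MvPolynomial (Fin n) ℝ),
      (∀ d ≥ D, q ∈ feasiblePolynomials Kminus Kplus (box l u) d) ∧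
      ∀ x ∈ box l u, |MvPolynomial.eval x q - f x| ≤ ε := by
  obtain ⟨q, hq, hqf⟩ := hf.slopeBounded.exists_mvPolynomial_close hlu hε
  exact ⟨q.totalDegree, q, fun d hd =>
    ⟨hd, hq.hasKBoundedDerivatives hlu (contDiff_mvPolynomial_eval q).contDiffOn⟩, hqf⟩

/-! ### Deterministic analysis of the least-squares problem -/

theorem IsCompact.exists_measurable_quantizer {E : Type*} [PseudoMetricSpace E]
    [MeasurableSpace E] [OpensMeasurableSpace E] {B : Set E} (hB : IsCompact B) (hne : B.Nonempty)
    {δ : ℝ} (hδ : 0 < δ) :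
    ∃ (t : Finset E) (π : E → E), ↑t ⊆ B ∧ Measurable π ∧
      ∀ x ∈ B, π x ∈ t ∧ dist x (π x) < δ := by
  classical
  obtain ⟨t, htB, htfin, hcover⟩ := hB.finite_cover_balls hδ
  lift t to Finset E using htfin
  obtain ⟨z, hz⟩ := hne
  have key : ∀ s : Finset E, ∃ π : E → E, Measurable π ∧
      ∀ x ∈ ⋃ c ∈ s, Metric.ball c δ, π x ∈ s ∧ dist x (π x) < δ := by
    intro s
    induction s using Finset.induction_on with
    | empty => exact ⟨fun _ => z, measurable_const, by simp⟩
    | insert a s ha ih =>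
      obtain ⟨π, hπ, h⟩ := ih
      refine ⟨(Metric.ball a δ).piecewise (fun _ => a) π,
        Measurable.piecewise measurableSet_ball measurable_const hπ, fun x hx => ?_⟩
      by_cases hxa : x ∈ Metric.ball a δ
      · rw [Set.piecewise_eq_of_mem _ _ _ hxa]
        exact ⟨Finset.mem_insert_self _ _, hxa⟩
      · rw [Set.piecewise_eq_of_notMem _ _ _ hxa]
        rw [Finset.set_biUnion_insert] at hx
        obtain ⟨h1, h2⟩ := h x (hx.resolve_left hxa)
        exact ⟨Finset.mem_insert_of_mem h1, h2⟩
  obtain ⟨π, hπ, h⟩ := key t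
  exact ⟨t, π, htB, hπ, fun x hx => h x (hcover hx)⟩

/-- Replacing `g (x i)` by `g (π (x i))` costs at most `L * δ` per unit of `|v i|`. What remains
depends on `g` only through finitely many values, each multiplying a cell sum that is independent of
`g`. -/
theorem abs_sum_mul_le_of_quantizer {E : Type*} [PseudoMetricSpace E] {B : Set E} {t : Finset E}
    {π : E → E} {δ : ℝ} (htB : ↑t ⊆ B) (hπ : ∀ x ∈ B, π x ∈ t ∧ dist x (π x) < δ)
    {x : ℕ → E} (hx : ∀ i, x i ∈ B) (v : ℕ → ℝ) {g : E → ℝ} {L M : ℝ} (hL : 0 ≤ L)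
    (hg : ∀ y ∈ B, ∀ z ∈ B, |g y - g z| ≤ L * dist y z) (hM : ∀ y ∈ B, |g y| ≤ M) (m : ℕ) :
    |∑ i ∈ Finset.range m, v i * g (x i)| ≤ L * δ * ∑ i ∈ Finset.range m, |v i| +
      M * ∑ c ∈ t, |∑ i ∈ Finset.range m, (π ⁻¹' {c}).indicator (fun _ => (1 : ℝ)) (x i) * v i| := by
  classical
  have hsplit : ∑ i ∈ Finset.range m, v i * g (x i) =
      ∑ i ∈ Finset.range m, v i * (g (x i) - g (π (x i))) +
      ∑ c ∈ t, g c * ∑ i ∈ Finset.range m,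
        (π ⁻¹' {c}).indicator (fun _ => (1 : ℝ)) (x i) * v i := by
    simp_rw [Finset.mul_sum]
    rw [Finset.sum_comm, ← Finset.sum_add_distrib]
    refine Finset.sum_congr rfl fun i _ => ?_
    rw [Finset.sum_eq_single_of_mem (π (x i)) (hπ _ (hx i)).1]
    · simp; ring
    · intro c _ hc
      simp [Set.indicator, hc.symm]
  rw [hsplit]
  refine (abs_add_le _ _).trans (add_le_add ?_ ?_)
  · refine (Finset.abs_sum_le_sum_abs _ _).trans ?_
    rw [Finset.mul_sum]
    refine Finset.sum_le_sum fun i _ => ?_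
    obtain ⟨h1, h2⟩ := hπ _ (hx i)
    rw [abs_mul, mul_comm]
    refine mul_le_mul_of_nonneg_right ((hg _ (hx i) _ (htB h1)).trans ?_) (abs_nonneg _)
    gcongr
  · refine (Finset.abs_sum_le_sum_abs _ _).trans ?_
    rw [Finset.mul_sum]
    refine Finset.sum_le_sum fun c hc => ?_
    rw [abs_mul]
    exact mul_le_mul_of_nonneg_right (hM c (htB hc)) (abs_nonneg _)

/-- A noise whose averages over all cells of arbitrarily fine partitions vanish is uniformly
negligible on equi-Lipschitz functions. -/
theorem eventually_abs_sum_mul_le {E : Type*} [PseudoMetricSpace E] {B : Set E} {x : ℕ → E}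
    {v : ℕ → ℝ} (hx : ∀ i, x i ∈ B) {t : ℕ → Finset E} {π : ℕ → E → E} (htB : ∀ k, ↑(t k) ⊆ B)
    (hπ : ∀ k : ℕ, ∀ y ∈ B, π k y ∈ t k ∧ dist y (π k y) < 1 / ((k : ℝ) + 1))
    (habs : ∃ A : ℝ, ∀ᶠ m : ℕ in atTop, ∑ i ∈ Finset.range m, |v i| ≤ A * m)
    (hcell : ∀ k, ∀ c ∈ t k, Tendsto (fun m : ℕ => (∑ i ∈ Finset.range m,
      (π k ⁻¹' {c}).indicator (fun _ => (1 : ℝ)) (x i) * v i) / m) atTop (𝓝 0))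
    {L : ℝ} (hL : 0 ≤ L) {η : ℝ} (hη : 0 < η) :
    ∀ᶠ m : ℕ in atTop, ∀ (g : E → ℝ) (M : ℝ),
      (∀ y ∈ B, ∀ z ∈ B, |g y - g z| ≤ L * dist y z) → (∀ y ∈ B, |g y| ≤ M) →
      |∑ i ∈ Finset.range m, v i * g (x i)| ≤ η * (1 + M) * m := by
  obtain ⟨A, hA⟩ := habs
  -- The mesh `1 / (k + 1)` depends on `L`, `A` and `η` only, so the threshold for `m` is uniform in
  -- `g` and `M`.
  obtain ⟨k, hk⟩ := exists_nat_gt (L * A / η)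
  have hk1 : (0 : ℝ) < k + 1 := by positivity
  have hkη : L * (1 / ((k : ℝ) + 1)) * A ≤ η := by
    rw [div_lt_iff₀ hη] at hk
    have : L * (1 / ((k : ℝ) + 1)) * A = L * A / (k + 1) := by ring
    rw [this, div_le_iff₀ hk1]
    linarith
  have hsum : Tendsto (fun m : ℕ => ∑ c ∈ t k, |(∑ i ∈ Finset.range m,
      (π k ⁻¹' {c}).indicator (fun _ => (1 : ℝ)) (x i) * v i) / m|) atTop (𝓝 0) := by
    rw [← Finset.sum_const_zero (s := t k) (ι := E) (M := ℝ)]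
    exact tendsto_finsetSum _ fun c hc => by simpa using (hcell k c hc).abs
  filter_upwards [hA, hsum.eventually_lt_const hη, eventually_gt_atTop 0]
    with m hAm hm hm0 g M hg hM
  have hm0' : (0 : ℝ) < m := by exact_mod_cast hm0
  have hM0 : 0 ≤ M := (abs_nonneg _).trans (hM _ (hx 0))
  refine (abs_sum_mul_le_of_quantizer (htB k) (hπ k) hx v hL hg hM m).trans ?_
  have h1 : L * (1 / ((k : ℝ) + 1)) * ∑ i ∈ Finset.range m, |v i| ≤ η * m :=
    calc _ ≤ L * (1 / ((k : ℝ) + 1)) * (A * m) := by gcongr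
      _ = L * (1 / ((k : ℝ) + 1)) * A * m := by ring
      _ ≤ _ := by gcongr
  simp only [abs_div, Nat.abs_cast, ← Finset.sum_div] at hm
  rw [div_lt_iff₀ hm0'] at hm
  nlinarith [mul_le_mul_of_nonneg_left hm.le hM0]

/-- The basic inequality of least squares: a minimizer does not fit the regression function worse
than a competitor, up to a noise term. -/
theorem sum_sq_sub_le_of_squaredLoss_le {n : ℕ} {m : ℕ} {x : ℕ → Fin n → ℝ} {y v : ℕ → ℝ}
    {f : (Fin n → ℝ) → ℝ} (hy : ∀ i, y i = f (x i) + v i) {p q : MvPolynomial (Fin n) ℝ}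
    (h : squaredLoss m x y p ≤ squaredLoss m x y q) :
    ∑ i ∈ Finset.range m, (MvPolynomial.eval (x i) p - f (x i)) ^ 2 ≤
      ∑ i ∈ Finset.range m, (MvPolynomial.eval (x i) q - f (x i)) ^ 2 +
      2 * ∑ i ∈ Finset.range m, v i * (MvPolynomial.eval (x i) p - MvPolynomial.eval (x i) q) := by
  have e : ∀ r : MvPolynomial (Fin n) ℝ, squaredLoss m x y r =
      ∑ i ∈ Finset.range m, (MvPolynomial.eval (x i) r - f (x i)) ^ 2 -
      2 * ∑ i ∈ Finset.range m, v i * (MvPolynomial.eval (x i) r - f (x i)) +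
      ∑ i ∈ Finset.range m, v i ^ 2 := fun r => by
    rw [Finset.mul_sum, ← Finset.sum_sub_distrib, ← Finset.sum_add_distrib]
    refine Finset.sum_congr rfl fun i _ => ?_
    rw [hy]; ring
  have e2 : ∑ i ∈ Finset.range m,
        v i * (MvPolynomial.eval (x i) p - MvPolynomial.eval (x i) q) =
      ∑ i ∈ Finset.range m, v i * (MvPolynomial.eval (x i) p - f (x i)) -
      ∑ i ∈ Finset.range m, v i * (MvPolynomial.eval (x i) q - f (x i)) := by
    rw [← Finset.sum_sub_distrib]
    exact Finset.sum_congr rfl fun i _ => by ring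
  rw [e, e] at h
  rw [e2]
  linarith

theorem eventually_forall_mass_le {E : Type*} [PseudoMetricSpace E] {x : ℕ → E} {t : Finset E}
    {r : ℝ} (hmass : ∀ c ∈ t, ∃ ρ : ℝ, 0 < ρ ∧ ∀ᶠ m : ℕ in atTop,
      ρ * m ≤ ∑ i ∈ Finset.range m, (Metric.ball c r).indicator (fun _ => (1 : ℝ)) (x i)) :
    ∃ ρ : ℝ, 0 < ρ ∧ ∀ᶠ m : ℕ in atTop, ∀ c ∈ t,
      ρ * m ≤ ∑ i ∈ Finset.range m, (Metric.ball c r).indicator (fun _ => (1 : ℝ)) (x i) := by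
  choose! ρ hρ hev using hmass
  rcases t.eq_empty_or_nonempty with rfl | hne
  · exact ⟨1, one_pos, by simp⟩
  · obtain ⟨c₀, hc₀, hmin⟩ := t.exists_min_image ρ hne
    refine ⟨ρ c₀, hρ c₀ hc₀, ?_⟩
    filter_upwards [(eventually_all_finset t).2 hev] with m hm c hc
    exact (mul_le_mul_of_nonneg_right (hmin c hc) (by positivity)).trans (hm c hc)

/-- The sum of the squares of an `L`-Lipschitz function `e` is bounded below by the number of
sample points near `z` times `(|e z| / 2) ^ 2`. -/
theorem mass_mul_sq_le_sum_sq {E : Type*} [PseudoMetricSpace E] {B : Set E} {x : ℕ → E}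
    (hx : ∀ i, x i ∈ B) {e : E → ℝ} {L r : ℝ} (hL : 0 ≤ L)
    (he : ∀ y ∈ B, ∀ w ∈ B, |e y - e w| ≤ L * dist y w) {z c : E} (hz : z ∈ B)
    (hzc : dist z c < r) (hLr : L * (2 * r) ≤ |e z| / 2) (m : ℕ) :
    (∑ i ∈ Finset.range m, (Metric.ball c r).indicator (fun _ => (1 : ℝ)) (x i)) *
      (|e z| / 2) ^ 2 ≤ ∑ i ∈ Finset.range m, e (x i) ^ 2 := by
  rw [Finset.sum_mul]
  refine Finset.sum_le_sum fun i _ => ?_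
  by_cases hi : x i ∈ Metric.ball c r
  · rw [Set.indicator_of_mem hi, one_mul, ← sq_abs (e (x i))]
    have hd : dist z (x i) ≤ 2 * r := by
      have := dist_triangle_right z (x i) c
      have h2 : dist (x i) c < r := hi
      linarith
    have h1 := (he z hz (x i) (hx i)).trans (mul_le_mul_of_nonneg_left hd hL)
    have h2 := abs_sub_abs_le_abs_sub (e z) (e (x i))
    gcongr
    linarith
  · rw [Set.indicator_of_notMem hi, zero_mul]
    positivity

/-- This is the argument along one sample path. The polynomial is quantified after the filter, so no
choice of minimizers matters. -/
theorem eventually_regressor_close {n : ℕ} {l u : Fin n → ℝ} (hlu : ∀ i, l i < u i)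
    {Kminus Kplus : Fin n → ℝ} {f : (Fin n → ℝ) → ℝ}
    (hf : HasKBoundedDerivatives Kminus Kplus (box l u) f)
    {x : ℕ → Fin n → ℝ} {y v : ℕ → ℝ} (hx : ∀ i, x i ∈ box l u) (hy : ∀ i, y i = f (x i) + v i)
    {t : ℕ → Finset (Fin n → ℝ)} {π : ℕ → (Fin n → ℝ) → Fin n → ℝ} (htB : ∀ k, ↑(t k) ⊆ box l u)
    (hπ : ∀ k : ℕ, ∀ z ∈ box l u, π k z ∈ t k ∧ dist z (π k z) < 1 / ((k : ℝ) + 1))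
    (habs : ∃ A : ℝ, ∀ᶠ m : ℕ in atTop, ∑ i ∈ Finset.range m, |v i| ≤ A * m)
    (hcell : ∀ k, ∀ c ∈ t k, Tendsto (fun m : ℕ => (∑ i ∈ Finset.range m,
      (π k ⁻¹' {c}).indicator (fun _ => (1 : ℝ)) (x i) * v i) / m) atTop (𝓝 0))
    (hmass : ∀ k : ℕ, ∀ c ∈ t k, ∃ ρ : ℝ, 0 < ρ ∧ ∀ᶠ m : ℕ in atTop, ρ * m ≤
      ∑ i ∈ Finset.range m, (Metric.ball c (1 / ((k : ℝ) + 1))).indicator (fun _ => (1 : ℝ)) (x i))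
    {η : ℝ} (hη : 0 < η) :
    ∀ᶠ md : ℕ × ℕ in atTop ×ˢ atTop, ∀ p : MvPolynomial (Fin n) ℝ,
      IsBoundedDerivativeRegressor Kminus Kplus (box l u) md.1 md.2 x y p →
      ∀ z ∈ box l u, |MvPolynomial.eval z p - f z| ≤ η := by
  set L := 2 * ∑ i, max |Kminus i| |Kplus i| with hLdef
  have hL : 0 ≤ L := mul_nonneg zero_le_two
    (Finset.sum_nonneg fun i _ => (abs_nonneg _).trans (le_max_left _ _))
  have hlip : ∀ g h : (Fin n → ℝ) → ℝ, SlopeBounded Kminus Kplus l u g →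
      SlopeBounded Kminus Kplus l u h → ∀ a ∈ box l u, ∀ b ∈ box l u,
      |(g a - h a) - (g b - h b)| ≤ L * dist a b := fun g h hg hh a ha b hb => by
    have h1 := hg.abs_sub_le ha hb
    have h2 := hh.abs_sub_le ha hb
    have h3 := abs_sub (g a - g b) (h a - h b)
    rw [show g a - h a - (g b - h b) = g a - g b - (h a - h b) by ring, hLdef]
    linarith
  -- Over a ball of radius `1 / (k + 1)` the error varies by at most `η / 2`, hence by less than
  -- half of a maximum exceeding `η`.
  obtain ⟨k, hk⟩ := exists_nat_gt (L * 4 / η)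
  have hkr : L * (2 * (1 / ((k : ℝ) + 1))) ≤ η / 2 := by
    have hk1 : (0 : ℝ) < k + 1 := by positivity
    rw [div_lt_iff₀ hη] at hk
    rw [show L * (2 * (1 / ((k : ℝ) + 1))) = L * 2 / (k + 1) by ring, div_le_iff₀ hk1]
    linarith
  obtain ⟨ρ, hρ, hmassk⟩ := eventually_forall_mass_le (hmass k)
  set ε := min 1 (ρ * η ^ 2 / 16) with hεdef
  have hε : 0 < ε := lt_min one_pos (by positivity)
  have hε1 : ε ≤ 1 := min_le_left _ _
  have hε2 : ε ≤ ρ * η ^ 2 / 16 := min_le_right _ _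
  obtain ⟨D, q, hq, hqf⟩ := hf.exists_feasiblePolynomials_close hlu hε
  -- Chosen so that `1 + (M + ε) ≤ S * M ^ 2` whenever `M ≥ η` and `ε ≤ 1`: the affine noise bound
  -- is absorbed into the quadratic term.
  set S := 2 / η ^ 2 + 1 / η with hS
  have hSpos : 0 < S := by positivity
  have hnoise := eventually_abs_sum_mul_le hx htB hπ habs hcell hL
    (η := ρ / (64 * S)) (by positivity)
  have hm := (hnoise.and hmassk).and (eventually_gt_atTop 0)
  filter_upwards [hm.prod_mk (eventually_ge_atTop D)] with md hmd p hp
  obtain ⟨⟨⟨hN, hM⟩, hm0⟩, hd⟩ := hmd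
  set m := md.1
  have hm0' : (0 : ℝ) < m := by exact_mod_cast hm0
  have hpS := hp.1.2.slopeBounded
  have hqS := (hq md.2 hd).2.slopeBounded
  have hcont : ContinuousOn (fun z => |MvPolynomial.eval z p - f z|) (box l u) :=
    (hp.1.2.1.continuousOn.sub hf.1.continuousOn).abs
  obtain ⟨z, hz, hzmax⟩ := (isCompact_box l u).exists_isMaxOn ⟨_, hx 0⟩ hcont
  suffices h : |MvPolynomial.eval z p - f z| ≤ η from fun w hw => (hzmax hw).trans h
  by_contra! hcon
  set M := |MvPolynomial.eval z p - f z| with hMdef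
  have hmax : ∀ w ∈ box l u, |MvPolynomial.eval w p - f w| ≤ M := fun w hw => hzmax hw
  obtain ⟨hct, hzc⟩ := hπ k z hz
  have hlow := mass_mul_sq_le_sum_sq hx (e := fun z => MvPolynomial.eval z p - f z) hL
    (hlip _ _ hpS hf.slopeBounded) hz hzc (by linarith) m
  have hup := sum_sq_sub_le_of_squaredLoss_le hy (hp.2 q (hq md.2 hd))
  have hfit : ∑ i ∈ Finset.range m, (MvPolynomial.eval (x i) q - f (x i)) ^ 2 ≤ m * ε ^ 2 :=
    calc _ ≤ ∑ i ∈ Finset.range m, ε ^ 2 := Finset.sum_le_sum fun i _ => by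
          rw [← sq_abs]
          gcongr
          exact hqf _ (hx i)
      _ = _ := by simp
  have hno := (le_abs_self _).trans (hN (fun z => MvPolynomial.eval z p - MvPolynomial.eval z q)
    (M + ε) (hlip _ _ hpS hqS) fun w hw => by
      have h1 := hmax w hw
      have h2 := hqf w hw
      have h3 := abs_sub (MvPolynomial.eval w p - f w) (MvPolynomial.eval w q - f w)
      rw [sub_sub_sub_cancel_right] at h3
      linarith)
  have hmass' := mul_le_mul_of_nonneg_right (hM _ hct) (sq_nonneg (M / 2))
  have htotal : ρ * m * (M / 2) ^ 2 ≤
      m * ε ^ 2 + 2 * (ρ / (64 * S) * (1 + (M + ε)) * m) := by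
    simp only [← hMdef] at hlow
    linarith
  have hdiv : ρ * (M / 2) ^ 2 ≤ ε ^ 2 + 2 * (ρ / (64 * S) * (1 + (M + ε))) := by
    refine le_of_mul_le_mul_right ?_ hm0'
    linarith
  have hMη : 1 ≤ M / η := (one_le_div hη).2 hcon.le
  have h2M : 1 + (M + ε) ≤ S * M ^ 2 := by
    have : S * M ^ 2 = 2 * (M / η) ^ 2 + M * (M / η) := by rw [hS]; field_simp
    have hM0 : 0 ≤ M := abs_nonneg _
    nlinarith
  have hnoiseM : ρ / (64 * S) * (1 + (M + ε)) ≤ ρ * M ^ 2 / 64 :=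
    calc _ ≤ ρ / (64 * S) * (S * M ^ 2) := by gcongr
      _ = _ := by field_simp
  have hηM : ρ * η ^ 2 ≤ ρ * M ^ 2 := by gcongr
  have hpos : 0 < ρ * M ^ 2 := by have := hη.trans hcon; positivity
  -- Here `ε ^ 2 ≤ ε ≤ ρ * M ^ 2 / 16` and the noise adds at most `ρ * M ^ 2 / 32`, against `ρ * M ^
  -- 2 / 4` on the left.
  nlinarith

/-! ### Almost sure properties of the sample -/

/-- Centering turns pairwise independence into orthogonality. Identical distribution is not
required, which matters because the noise laws may vary with `i`. -/
theorem ae_tendsto_average_sub_integral {Ω : Type*} [MeasurableSpace Ω] {μ : Measure Ω}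
    [IsProbabilityMeasure μ] {W : ℕ → Ω → ℝ} {V : ℝ} (hL2 : ∀ i, MemLp (W i) 2 μ)
    (hind : Pairwise fun i j => IndepFun (W i) (W j) μ) (hV : ∀ i, ∫ ω, W i ω ^ 2 ∂μ ≤ V) :
    ∀ᵐ ω ∂μ, Tendsto (fun m : ℕ => (∑ i ∈ Finset.range m, (W i ω - ∫ ω', W i ω' ∂μ)) / m)
      atTop (𝓝 0) := by
  have hi : ∀ i, Integrable (W i) μ := fun i => (hL2 i).integrable one_le_two
  have hZ : ∀ i, MemLp (fun ω => W i ω - ∫ ω', W i ω' ∂μ) 2 μ := fun i =>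
    (hL2 i).sub (memLp_const _)
  have hzero : ∀ i, ∫ ω, (W i ω - ∫ ω', W i ω' ∂μ) ∂μ = 0 := fun i => by
    rw [integral_sub (hi i) (integrable_const _)]; simp
  refine ae_tendsto_average_of_orthogonal (V := V) hZ (fun i j hij => ?_) fun i => ?_
  · have h := (hind hij).comp (measurable_id.sub_const (∫ ω', W i ω' ∂μ))
      (measurable_id.sub_const (∫ ω', W j ω' ∂μ))
    have := h.integral_mul_eq_mul_integral (hZ i).1 (hZ j).1
    have h0 := hzero i
    simp only [Function.comp_def, id, Pi.mul_def] at this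
    rw [this, h0, zero_mul]
  · have := variance_le_expectation_sq (hL2 i).1
    rw [variance_eq_integral (hL2 i).1.aemeasurable] at this
    exact this.trans (hV i)

section

variable {Ω : Type*} [MeasurableSpace Ω] {μ : Measure Ω} [IsProbabilityMeasure μ] {n : ℕ}
  {X : ℕ → Ω → Fin n → ℝ} {Y ν : ℕ → Ω → ℝ} {B : Set (Fin n → ℝ)} {f : (Fin n → ℝ) → ℝ} {σ : ℝ}

theorem NoisyResponses.ae_tendsto_cell_noise (hX : FeaturesIID μ X)
    (hY : NoisyResponses μ X Y ν B f σ) {E : Set (Fin n → ℝ)} (hE : MeasurableSet E) :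
    ∀ᵐ ω ∂μ, Tendsto (fun m : ℕ => (∑ i ∈ Finset.range m,
      E.indicator (fun _ => (1 : ℝ)) (X i ω) * ν i ω) / m) atTop (𝓝 0) := by
  have hform : ∀ i, (fun ω => E.indicator (fun _ => (1 : ℝ)) (X i ω) * ν i ω) =
      (X i ⁻¹' E).indicator (ν i) := fun i => by
    funext ω
    by_cases h : X i ω ∈ E <;> simp [Set.indicator, h]
  have hXE : ∀ i, MeasurableSet (X i ⁻¹' E) := fun i => hX.measurable i hE
  have hmem : ∀ i, MemLp (fun ω => E.indicator (fun _ => (1 : ℝ)) (X i ω) * ν i ω) 2 μ :=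
    fun i => by rw [hform]; exact (hY.memLp i).indicator (hXE i)
  have hφ : Measurable fun z : (Fin n → ℝ) × ℝ => E.indicator (fun _ => (1 : ℝ)) z.1 * z.2 :=
    ((measurable_const.indicator hE).comp measurable_fst).mul measurable_snd
  -- A cell is an event of the feature alone, so conditional centering gives mean zero on it.
  have hmean : ∀ i, ∫ ω, E.indicator (fun _ => (1 : ℝ)) (X i ω) * ν i ω ∂μ = 0 := fun i => by
    rw [hform, integral_indicator (hXE i), ← setIntegral_condExp (hX.measurable i).comap_le
      ((hY.memLp i).integrable one_le_two) ⟨E, hE, rfl⟩,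
      setIntegral_congr_ae (g := 0) (hXE i) ((hY.condMean i).mono fun ω h _ => h)]
    simp
  have := ae_tendsto_average_sub_integral (V := σ ^ 2) hmem
    (fun i j hij => (hY.indepFun_pair hX hij).comp hφ hφ) fun i => by
      rw [← hY.secondMoment i]
      refine integral_mono (hmem i).integrable_sq (hY.memLp i).integrable_sq fun ω => ?_
      by_cases h : X i ω ∈ E <;> simp [Set.indicator, h, sq_nonneg]
  simpa only [hmean, sub_zero] using this

theorem NoisyResponses.ae_sum_abs_noise_le (hX : FeaturesIID μ X)
    (hY : NoisyResponses μ X Y ν B f σ) :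
    ∀ᵐ ω ∂μ, ∃ A : ℝ, ∀ᶠ m : ℕ in atTop, ∑ i ∈ Finset.range m, |ν i ω| ≤ A * m := by
  have habs : Measurable fun z : (Fin n → ℝ) × ℝ => |z.2| := measurable_snd.abs
  have hle : ∀ i, ∫ ω, |ν i ω| ∂μ ≤ 1 + σ ^ 2 := fun i => by
    have h2 : ∫ ω, (1 + ν i ω ^ 2) ∂μ = 1 + σ ^ 2 := by
      rw [integral_add (integrable_const _) (hY.memLp i).integrable_sq, hY.secondMoment]
      simp
    rw [← h2]
    refine integral_mono ((hY.memLp i).integrable one_le_two).abs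
      ((integrable_const _).add (hY.memLp i).integrable_sq) fun ω => ?_
    simp only
    rw [← sq_abs (ν i ω)]
    nlinarith [sq_nonneg (|ν i ω| - 1), abs_nonneg (ν i ω)]
  have := ae_tendsto_average_sub_integral (V := σ ^ 2) (fun i => (hY.memLp i).abs)
    (fun i j hij => (hY.indepFun_pair hX hij).comp habs habs) fun i => by
      simp only [Pi.abs_apply, sq_abs]
      exact (hY.secondMoment i).le
  filter_upwards [this] with ω hω
  -- The mean of `|ν i|` is at most `1 + σ ^ 2`; the extra one absorbs the fluctuation of the
  -- average.
  refine ⟨2 + σ ^ 2, ?_⟩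
  filter_upwards [hω.eventually_lt_const one_pos, eventually_gt_atTop 0] with m hm hm0
  have hm0' : (0 : ℝ) < m := by exact_mod_cast hm0
  rw [div_lt_iff₀ hm0', Finset.sum_sub_distrib] at hm
  have h2 : ∑ i ∈ Finset.range m, ∫ ω', |ν i| ω' ∂μ ≤ m * (1 + σ ^ 2) :=
    (Finset.sum_le_sum fun i _ => hle i).trans (by simp [mul_add])
  simp only [Pi.abs_apply] at hm h2
  linarith

theorem FeaturesIID.ae_mass_le (hX : FeaturesIID μ X) {E : Set (Fin n → ℝ)}
    (hE : MeasurableSet E) (hpos : 0 < μ (X 0 ⁻¹' E)) :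
    ∀ᵐ ω ∂μ, ∃ ρ : ℝ, 0 < ρ ∧ ∀ᶠ m : ℕ in atTop,
      ρ * m ≤ ∑ i ∈ Finset.range m, E.indicator (fun _ => (1 : ℝ)) (X i ω) := by
  have hφ : Measurable (E.indicator fun _ => (1 : ℝ)) := measurable_const.indicator hE
  have hmem : ∀ i, MemLp (fun ω => E.indicator (fun _ => (1 : ℝ)) (X i ω)) 2 μ := fun i =>
    MemLp.of_bound (hφ.comp (hX.measurable i)).aestronglyMeasurable 1 (ae_of_all _ fun ω => by
      by_cases h : X i ω ∈ E <;> simp [h])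
  have hmean : ∀ i, ∫ ω, E.indicator (fun _ => (1 : ℝ)) (X i ω) ∂μ = μ.real (X 0 ⁻¹' E) :=
    fun i => by
      have h0 : ∫ ω, E.indicator (fun _ => (1 : ℝ)) (X 0 ω) ∂μ = μ.real (X 0 ⁻¹' E) := by
        rw [← integral_indicator_one (hX.measurable 0 hE)]
        rfl
      rw [← h0]
      exact ((hX.identDistrib i).comp hφ).integral_eq
  have := ae_tendsto_average_sub_integral (V := 1) hmem
    (fun i j hij => (hX.indep.indepFun hij).comp hφ hφ) fun i => by
      have h1 : ∫ _, (1 : ℝ) ∂μ = 1 := by simp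
      refine (integral_mono (hmem i).integrable_sq (integrable_const 1) fun ω => ?_).trans h1.le
      by_cases h : X i ω ∈ E <;> simp [h]
  have hp : 0 < μ.real (X 0 ⁻¹' E) := ENNReal.toReal_pos hpos.ne' (measure_ne_top _ _)
  filter_upwards [this] with ω hω
  refine ⟨μ.real (X 0 ⁻¹' E) / 2, half_pos hp, ?_⟩
  filter_upwards [hω.eventually_const_lt (show -(μ.real (X 0 ⁻¹' E) / 2) < 0 by linarith),
    eventually_gt_atTop 0] with m hm hm0
  have hm0' : (0 : ℝ) < m := by exact_mod_cast hm0
  rw [lt_div_iff₀ hm0', Finset.sum_sub_distrib] at hm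
  simp only [hmean, Finset.sum_const, Finset.card_range, nsmul_eq_mul] at hm
  linarith

end

/-- The center may lie on a face, but a nondegenerate box is the closure of its interior, so the
ball meets the box in a full-dimensional set. -/
theorem FeaturesSupportedOn.measure_ball_pos {Ω : Type*} [MeasurableSpace Ω] {μ : Measure Ω}
    {n : ℕ} {X : ℕ → Ω → Fin n → ℝ} {l u : Fin n → ℝ} (hlu : ∀ i, l i < u i)
    (hB : FeaturesSupportedOn μ X (box l u)) {c : Fin n → ℝ} (hc : c ∈ box l u) {r : ℝ}
    (hr : 0 < r) (i : ℕ) : 0 < μ (X i ⁻¹' Metric.ball c r) := by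
  refine (hB.pos i (Metric.ball c r ∩ box l u) Set.inter_subset_right ?_).trans_le
    (measure_mono (Set.preimage_mono Set.inter_subset_left))
  have hint : interior (box l u) = Set.univ.pi fun i => Set.Ioo (l i) (u i) := by
    rw [box_eq_pi, interior_pi_set Set.finite_univ]
    simp only [interior_Icc]
  have hcl : c ∈ closure (interior (box l u)) := by
    rw [hint, closure_pi_set]
    simp only [closure_Ioo (hlu _).ne]
    rwa [← box_eq_pi]
  rw [FullDimensional, interior_inter, Metric.isOpen_ball.interior_eq]
  exact mem_closure_iff.1 hcl _ Metric.isOpen_ball (Metric.mem_ball_self hr)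

/-! ### Uniform consistency -/

theorem lemma2 {n : ℕ} (l u : Fin n → ℝ) (hlu : ∀ i, l i < u i)
    (Kminus Kplus : Fin n → ℝ) (hK : ∀ i, Kminus i < Kplus i)
    {Ω : Type*} [MeasurableSpace Ω] (μ : Measure Ω) [IsProbabilityMeasure μ]
    (X : ℕ → Ω → Fin n → ℝ) (Y ν : ℕ → Ω → ℝ) (f : (Fin n → ℝ) → ℝ) (σ : ℝ)
    (hf : HasKBoundedDerivatives Kminus Kplus (box l u) f)
    (hX : FeaturesIID μ X)
    (hB : FeaturesSupportedOn μ X (box l u))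
    (hY : NoisyResponses μ X Y ν (box l u) f σ)
    (hbar : ℕ → ℕ → Ω → MvPolynomial (Fin n) ℝ)
    (hhbar : ∀ᵐ ω ∂μ, ∀ m d : ℕ, 1 ≤ d →
      IsBoundedDerivativeRegressor Kminus Kplus (box l u) m d
        (fun i => X i ω) (fun i => Y i ω) (hbar m d ω))
    (C : Set (Fin n → ℝ)) (hCcompact : IsCompact C) (hCfull : FullDimensional C)
    (hCB : C ⊆ box l u) (hCfrontier : Disjoint C (frontier (box l u))) :
    ∀ᵐ ω ∂μ, Tendsto
      (fun md : ℕ × ℕ => ⨆ x : C, |MvPolynomial.eval (x : Fin n → ℝ) (hbar md.1 md.2 ω) - f x|)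
      (atTop ×ˢ atTop) (𝓝 0) := by
  have hne : (box l u).Nonempty := ⟨l, fun i => ⟨le_rfl, (hlu i).le⟩⟩
  choose t π htB hπmeas hπ using fun k : ℕ =>
    (isCompact_box l u).exists_measurable_quantizer hne (Nat.one_div_pos_of_nat (α := ℝ) (n := k))
  -- Only countably many pairs of a mesh and a cell occur, so one null set serves every accuracy
  -- `η`.
  have hcell : ∀ᵐ ω ∂μ, ∀ k, ∀ c ∈ t k, Tendsto (fun m : ℕ => (∑ i ∈ Finset.range m,
      (π k ⁻¹' {c}).indicator (fun _ => (1 : ℝ)) (X i ω) * ν i ω) / m) atTop (𝓝 0) :=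
    ae_all_iff.2 fun k => (ae_ball_iff (t k).countable_toSet).2 fun c _ =>
      hY.ae_tendsto_cell_noise hX (hπmeas k (measurableSet_singleton c))
  have hmass : ∀ᵐ ω ∂μ, ∀ k : ℕ, ∀ c ∈ t k, ∃ ρ : ℝ, 0 < ρ ∧ ∀ᶠ m : ℕ in atTop, ρ * m ≤
      ∑ i ∈ Finset.range m,
        (Metric.ball c (1 / ((k : ℝ) + 1))).indicator (fun _ => (1 : ℝ)) (X i ω) :=
    ae_all_iff.2 fun k => (ae_ball_iff (t k).countable_toSet).2 fun c hc =>
      hX.ae_mass_le measurableSet_ball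
        (hB.measure_ball_pos hlu (htB k hc) Nat.one_div_pos_of_nat 0)
  filter_upwards [hhbar, ae_all_iff.2 hB.ae_mem, ae_all_iff.2 hY.response,
    hY.ae_sum_abs_noise_le hX, hcell, hmass] with ω hreg hx hy habs hcell hmass
  rw [Metric.tendsto_nhds]
  intro η hη
  filter_upwards [eventually_regressor_close hlu hf hx hy htB hπ habs hcell hmass (half_pos hη),
    tendsto_snd.eventually (eventually_ge_atTop 1)] with md hmd hd
  rw [Real.dist_eq, sub_zero, abs_of_nonneg (Real.iSup_nonneg fun _ => abs_nonneg _)]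
  -- A supremum inherits only non-strict bounds, hence the use of `η / 2`.
  exact (Real.iSup_le (fun z : C => hmd _ (hreg _ _ hd) z (hCB z.2)) (half_pos hη).le).trans_lt
    (half_lt_self hη)
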